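/- Let $n>1$. Equip $\mathbb R^{2n}=\mathbb R^n\oplus\mathbb R^n$, with coordinates $(x,y)$, with the standard Euclidean and symplectic structures. Let $K=\frac1{\sqrt2}\begin{pmatrix}1&i\\ i&1\end{pmatrix}$ (blocks of order $n$); the map $(h,\bar h)\mapsto e^{-\pi i/4}K\binom{h}{\bar h}$, $h\in\mathbb C^n$, is a real-linear bijection onto $\mathbb R^{2n}$. Let $$M=\{(S,\sigma)\in \mathrm{Symm}(n,\mathbb C)\times\mathbb C^n:\ SS^*=1,\ S=S^t,\ \overline\sigma=-S^{-1}\sigma\}.$$ For $(S,\sigma)\in M$ let $L_{S,\sigma}\subset\mathbb R^{2n}$ be the set of real points of the complex affine subspace $\{e^{-\pi i/4}K\binom{Sw+\sigma}{w}: w\in\mathbb C^n\}$; it is an affine Lagrangian subspace of $\mathbb R^{2n}$ (with "complex coordinates" $(S,\sigma)$), and every affine Lagrangian subspace is obtained in this way. For a Schwartz function $f\in\mathcal S(\mathbb R^{2n})$ define the Lagrangian Radon transform $$\mathcal R_{comp}f(S,\sigma)=\int_{L_{S,\sigma}}f(v)\,d\mu(v),\qquad (S,\sigma)\in M,$$ where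 $\mu$ is the surface measure on $L_{S,\sigma}$ induced by the Euclidean structure. Suppose that $G$ is a holomorphic function on a connected open neighbourhood $\mathcal O$ of $M$ in $\mathrm{Symm}(n,\mathbb C)\times\mathbb C^n$ such that $G=\mathcal R_{comp}f$ on $M$. Then the two-valued holomorphic function $\det(S)^{-1/2}G(S,\sigma)$ satisfies the determinantal system $\mathfrak D_{flat}$ on $\mathcal O\cap\{\det S\neq0\}$. This means: if $U\subset\mathcal O$ is open and $\delta$ is a holomorphic function on $U$ with $\delta(S,\sigma)^2\det S=1$ for all $(S,\sigma)\in U$, then $\delta G$ is annihilated on $U$ by every $3\times3$ minor of the symmetric $(n+1)\times(n+1)$ matrix of commuting differential operators $$\begin{pmatrix} 2\frac{\partial}{\partial s_{11}}&\frac{\partial}{\partial s_{12}}&\cdots&\frac{\partial}{\partial s_{1n}}&\frac{\partial}{\partial\sigma_1}\\ \frac{\partial}{\partial s_{12}}&2\frac{\partial}{\partial s_{22}}&\cdots&\frac{\partial}{\partial s_{2n}}&\frac{\partial}{\partial\sigma_2}\\ \vdots&\vdots&\ddots&\vdots&\vdots\\ \frac{\partial}{\partial s_{1n}}&\frac{\partial}{\partial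 s_{2n}}&\cdots&2\frac{\partial}{\partial s_{nn}}&\frac{\partial}{\partial\sigma_n}\\ \frac{\partial}{\partial\sigma_1}&\frac{\partial}{\partial\sigma_2}&\cdots&\frac{\partial}{\partial\sigma_n}&0 \end{pmatrix},$$ where $s_{ij}$, $i\le j$, are the independent coordinates on $\mathrm{Symm}(n,\mathbb C)$. -/

import Mathlib

open Complex MeasureTheory
open scoped Matrix

noncomputable section

/-- The Euclidean phase space `ℝ^{2n} = ℝ^n ⊕ ℝ^n`; the coordinates `x` are indexed by `Sum.inl`,
the coordinates `y` by `Sum.inr`. -/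
abbrev PhaseSpace (n : ℕ) : Type := EuclideanSpace ℝ (Fin n ⊕ Fin n)

/-- The space `Symm(n, ℂ) × ℂ^n` of pairs `(S, σ)`. A symmetric matrix is given by its independent
entries `s_{ij} = s_{ji}`, indexed by unordered pairs of indices. -/
abbrev SymmSpace (n : ℕ) : Type := (Sym2 (Fin n) → ℂ) × (Fin n → ℂ)

/-- The symmetric matrix `S` of a point `(S, σ)`. -/
def SymmSpace.mat {n : ℕ} (p : SymmSpace n) : Matrix (Fin n) (Fin n) ℂ :=
  Matrix.of fun i j => p.1 s(i, j)

/-- The vector `σ` of a point `(S, σ)`. -/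
def SymmSpace.vec {n : ℕ} (p : SymmSpace n) : Fin n → ℂ := p.2

/-- The manifold `{(S, σ) : S S^* = 1, S = S^t, σ̄ = - S⁻¹ σ}` (symmetry of `S` is built into
`SymmSpace`). -/
def lagrangianLocus (n : ℕ) : Set (SymmSpace n) :=
  {p | p.mat * p.matᴴ = 1 ∧ star p.vec = -(p.mat⁻¹ *ᵥ p.vec)}

/-- The matrix `e^{-πi/4} K`, where `K = 2^{-1/2} [[1, i], [i, 1]]`. It carries the real form
`{(h, h̄)}` of `ℂ^{2n}` onto `ℝ^{2n}`. -/
def cayleyMatrix (n : ℕ) : Matrix (Fin n ⊕ Fin n) (Fin n ⊕ Fin n) ℂ :=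
  ((1 - I) / 2) • Matrix.fromBlocks 1 (I • 1) (I • 1) 1

/-- The set of real points of the complex affine subspace
`{e^{-πi/4} K (S w + σ, w) : w ∈ ℂ^n}` of `ℂ^{2n}`. If `(S, σ)` belongs to `lagrangianLocus n`,
this is the real affine Lagrangian subspace with complex coordinates `(S, σ)`. -/
def affineLagrangian {n : ℕ} (p : SymmSpace n) : AffineSubspace ℝ (PhaseSpace n) where
  carrier := {v | ∃ w : Fin n → ℂ,
    (fun k => (v k : ℂ)) = cayleyMatrix n *ᵥ Sum.elim (p.mat *ᵥ w + p.vec) w}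
  smul_vsub_vadd_mem' := by
    rintro c v₁ v₂ v₃ ⟨w₁, h₁⟩ ⟨w₂, h₂⟩ ⟨w₃, h₃⟩
    refine ⟨(c : ℂ) • (w₁ - w₂) + w₃, ?_⟩
    have e : (Sum.elim (p.mat *ᵥ ((c : ℂ) • (w₁ - w₂) + w₃) + p.vec) ((c : ℂ) • (w₁ - w₂) + w₃) :
        Fin n ⊕ Fin n → ℂ) = (c : ℂ) • (Sum.elim (p.mat *ᵥ w₁ + p.vec) w₁
          - Sum.elim (p.mat *ᵥ w₂ + p.vec) w₂) + Sum.elim (p.mat *ᵥ w₃ + p.vec) w₃ := by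
      funext k
      rcases k with k | k
      · simp [Matrix.mulVec_add, Matrix.mulVec_smul, Matrix.mulVec_sub]
        ring
      · simp
    rw [e, Matrix.mulVec_add, Matrix.mulVec_smul, Matrix.mulVec_sub, ← h₁, ← h₂, ← h₃]
    funext k
    simp

open Classical in
/-- The integral of `f` over an affine subspace `L` of a Euclidean space with respect to the
surface measure induced on `L` by the Euclidean structure: the Lebesgue measure of the direction
of `L`, normalized by orthonormal bases, is moved to `L` by a translation. -/
def integralOver {E : Type*} [NormedAddCommGroup E] [InnerProductSpace ℝ E]
    [FiniteDimensional ℝ E] [MeasurableSpace E] [BorelSpace E]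
    (f : E → ℂ) (L : AffineSubspace ℝ E) : ℂ :=
  if h : (L : Set E).Nonempty then
    ∫ u : L.direction, f ((u : E) + h.some) ∂(stdOrthonormalBasis ℝ L.direction).toBasis.addHaar
  else 0

/-- The Lagrangian Radon transform `R_comp f (S, σ)`, in complex coordinates. -/
def radonComp {n : ℕ} (f : SchwartzMap (PhaseSpace n) ℂ) (p : SymmSpace n) : ℂ :=
  integralOver f (affineLagrangian p)

/-- The vector fields in the entries of the symmetric matrix of differential operators
`[[(1 + δ_{ij}) ∂/∂s_{ij}, ∂/∂σ_i], [∂/∂σ_j, 0]]` of size `n + 1`; the index `none` stands for the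
last row and the last column. -/
def detDirection {n : ℕ} : Option (Fin n) → Option (Fin n) → SymmSpace n
  | some i, some j => (Pi.single s(i, j) (if i = j then 2 else 1), 0)
  | some i, none => (0, Pi.single i 1)
  | none, some j => (0, Pi.single j 1)
  | none, none => 0

/-- The entry `(a, b)` of the matrix of differential operators. -/
def detEntry {n : ℕ} (a b : Option (Fin n)) (F : SymmSpace n → ℂ) : SymmSpace n → ℂ :=
  fun p => fderiv ℂ F p (detDirection a b)

/-- The third-order differential operator given by the `3 × 3` minor of the matrix of
differential operators with rows `r` and columns `c`. -/
def detMinor {n : ℕ} (r c : Fin 3 ↪ Option (Fin n)) (F : SymmSpace n → ℂ) : SymmSpace n → ℂ :=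
  fun p => ∑ π : Equiv.Perm (Fin 3), ((Equiv.Perm.sign π : ℤ) : ℂ) *
    detEntry (r 0) (c (π 0)) (detEntry (r 1) (c (π 1)) (detEntry (r 2) (c (π 2)) F)) p

/-- `F` satisfies the flat determinantal system on the set `U`. -/
def SatisfiesFlatSystem {n : ℕ} (F : SymmSpace n → ℂ) (U : Set (SymmSpace n)) : Prop :=
  ∀ r c : Fin 3 ↪ Option (Fin n), ∀ p ∈ U, detMinor r c F p = 0

end

/-! In the complex coordinate `h` on phase space, `L_{S,σ}` is the set `h = S h̄ + σ`. A unitary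
motion `h ↦ U h + c` carries one such subspace to another and preserves surface measure.
Differentiating `G = R f` along one-parameter families of motions computes the derivative of `G`
along M as the transform of a first-order operator applied to `f`. Skew-Hermitian matrices span all
matrices over ℂ, and `c`, `i c` separate the linear and antilinear parts, so complex linearity of
the derivative of `G` yields every holomorphic derivative at points of M (`fderiv_vec_eq_radonLM`,
`fderiv_mat_eq_radonLM`).

After integration by parts along `L` (`radonLM_dirDeriv_tangent`), this reads `∂_{σ_i} G = R(∂_{h_i}
f)` and `(1 + δ_{ij}) ∂_{s_{ij}} G = (S⁻¹)_{ij} G + R((h̄_i ∂_{h_j} + h̄_j ∂_{h_i}) f)`. The factor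
`det(S)^{-1/2}` removes the term with `S⁻¹`. What remains is the matrix `x_a y_b + x_b y_a` with `x
= (h̄, 1)` and `y = (∂_h, 0)`. All these operators commute, so it behaves as a matrix of rank at
most two and its 3 × 3 minors vanish (`minor_entryOp`).

This proves the equations on M only. After division by a power of the branch `δ`, a minor applied to
`δ G` becomes a holomorphic function on all of `O`, and M is a set of uniqueness
(`eqOn_zero_of_eq_zero_on_lagrangianLocus`). -/

namespace LagrangianRadon

open scoped Topology LineDeriv

variable {n : ℕ}

/-! ### Complex coordinates on phase space and unitary isometries -/

/-- The complex coordinates `h = ((1 + i) x + (1 - i) y) / 2` on phase space. -/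
noncomputable def holo : PhaseSpace n →L[ℝ] (Fin n → ℂ) :=
  LinearMap.toContinuousLinearMap
    { toFun := fun v k => ((1 + I) * (v (Sum.inl k) : ℂ) + (1 - I) * (v (Sum.inr k) : ℂ)) / 2
      map_add' := fun v w => by
        funext k
        simp only [PiLp.add_apply, ofReal_add, Pi.add_apply]
        ring
      map_smul' := fun c v => by
        funext k
        simp only [PiLp.smul_apply, smul_eq_mul, ofReal_mul, RingHom.id_apply, Pi.smul_apply,
          real_smul]
        ring }

theorem holo_apply (v : PhaseSpace n) (k : Fin n) :
    holo v k = ((1 + I) * (v (Sum.inl k) : ℂ) + (1 - I) * (v (Sum.inr k) : ℂ)) / 2 := rfl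

/-- The point of phase space with given complex coordinates. -/
noncomputable def ofHolo : (Fin n → ℂ) →L[ℝ] PhaseSpace n :=
  LinearMap.toContinuousLinearMap
    { toFun := fun a => WithLp.toLp 2
        (Sum.elim (fun k => (a k).re + (a k).im) (fun k => (a k).re - (a k).im))
      map_add' := fun a b => by
        ext k
        rcases k with k | k <;> simp [add_add_add_comm, add_sub_add_comm]
      map_smul' := fun c a => by
        ext k
        rcases k with k | k <;> (simp; ring) }

@[simp] theorem ofHolo_inl (a : Fin n → ℂ) (k : Fin n) :
    ofHolo a (Sum.inl k) = (a k).re + (a k).im := rfl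

@[simp] theorem ofHolo_inr (a : Fin n → ℂ) (k : Fin n) :
    ofHolo a (Sum.inr k) = (a k).re - (a k).im := rfl

@[simp] theorem holo_ofHolo (a : Fin n → ℂ) : holo (ofHolo a) = a := by
  funext k
  rw [holo_apply]
  apply Complex.ext <;> simp <;> ring

@[simp] theorem ofHolo_holo (v : PhaseSpace n) : ofHolo (holo v) = v := by
  ext k
  rcases k with k | k <;> simp [holo_apply] <;> ring

theorem norm_ofHolo_sq (a : Fin n → ℂ) : ((‖ofHolo a‖ ^ 2 : ℝ) : ℂ) = 2 * (star a ⬝ᵥ a) := by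
  rw [EuclideanSpace.norm_sq_eq, Fintype.sum_sum_type, ← Finset.sum_add_distrib, ofReal_sum,
    dotProduct, Finset.mul_sum]
  refine Finset.sum_congr rfl fun k _ => ?_
  simp only [ofHolo_inl, ofHolo_inr, Real.norm_eq_abs, sq_abs, Pi.star_apply, RCLike.star_def]
  apply Complex.ext <;> simp [sq] <;> ring

theorem norm_ofHolo_mulVec {U : Matrix (Fin n) (Fin n) ℂ} (hU : Uᴴ * U = 1) (a : Fin n → ℂ) :
    ‖ofHolo (U *ᵥ a)‖ = ‖ofHolo a‖ := by
  have h : ((‖ofHolo (U *ᵥ a)‖ ^ 2 : ℝ) : ℂ) = ((‖ofHolo a‖ ^ 2 : ℝ) : ℂ) := by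
    rw [norm_ofHolo_sq, norm_ofHolo_sq, Matrix.star_mulVec, Matrix.dotProduct_mulVec,
      Matrix.vecMul_vecMul, hU, Matrix.vecMul_one]
  exact (sq_eq_sq₀ (norm_nonneg _) (norm_nonneg _)).1 (ofReal_injective h)

/-- The isometry of phase space given by a unitary matrix in complex coordinates. -/
noncomputable def rotation (U : Matrix (Fin n) (Fin n) ℂ) (hU : Uᴴ * U = 1) :
    PhaseSpace n ≃ₗᵢ[ℝ] PhaseSpace n :=
  LinearIsometry.toLinearIsometryEquiv
    { toLinearMap := ofHolo.toLinearMap ∘ₗ (Matrix.mulVecLin U).restrictScalars ℝ ∘ₗ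
        holo.toLinearMap
      norm_map' := fun v => by
        simpa using norm_ofHolo_mulVec hU (holo v) } rfl

theorem rotation_apply (U : Matrix (Fin n) (Fin n) ℂ) (hU : Uᴴ * U = 1) (v : PhaseSpace n) :
    rotation U hU v = ofHolo (U *ᵥ holo v) := rfl

/-- Inverting the Cayley matrix at a real point forces `w` to be the conjugate of `h`, so the
existential over `w` collapses to one real-linear equation. -/
theorem mem_affineLagrangian {p : SymmSpace n} {v : PhaseSpace n} :
    v ∈ affineLagrangian p ↔ holo v = p.mat *ᵥ star (holo v) + p.vec := by
  have key : ∀ a w : Fin n → ℂ, (fun k => (v k : ℂ)) = cayleyMatrix n *ᵥ Sum.elim a w ↔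
      holo v = a ∧ star (holo v) = w := by
    intro a w
    have e : cayleyMatrix n *ᵥ Sum.elim a w = Sum.elim (fun k => (1 - I) / 2 * (a k + I * w k))
        (fun k => (1 - I) / 2 * (I * a k + w k)) := by
      rw [cayleyMatrix, Matrix.smul_mulVec, Matrix.fromBlocks_mulVec]
      funext k
      rcases k with k | k <;> simp [Matrix.smul_mulVec]
    have hI : I * I = -1 := I_mul_I
    rw [e]
    constructor
    · intro h
      have h1 : ∀ k, (v (Sum.inl k) : ℂ) = (1 - I) / 2 * (a k + I * w k) := fun k => congrFun h _
      have h2 : ∀ k, (v (Sum.inr k) : ℂ) = (1 - I) / 2 * (I * a k + w k) := fun k => congrFun h _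
      constructor
      · funext k
        rw [holo_apply, h1, h2]
        linear_combination (-a k + ((1 + I) * a k + (1 - I) * w k) / 4) * hI
      · funext k
        simp only [Pi.star_apply, holo_apply, RCLike.star_def, map_div₀, map_add, map_mul, map_sub,
          map_one, conj_I, conj_ofReal, map_ofNat]
        rw [h1, h2]
        linear_combination (-w k + ((1 - I) * a k + (1 + I) * w k) / 4) * hI
    · rintro ⟨rfl, rfl⟩
      funext k
      rcases k with k | k <;>
        simp only [Sum.elim_inl, Sum.elim_inr, Pi.star_apply, holo_apply, RCLike.star_def, map_div₀,
          map_add, map_mul, map_sub, map_one, conj_I, conj_ofReal, map_ofNat]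
      · linear_combination (1 / 2 * (v (Sum.inl k) : ℂ) +
          (1 - I) / 4 * ((v (Sum.inl k) : ℂ) - (v (Sum.inr k) : ℂ))) * hI
      · linear_combination (1 / 2 * (v (Sum.inr k) : ℂ) +
          (1 - I) / 4 * ((v (Sum.inr k) : ℂ) - (v (Sum.inl k) : ℂ))) * hI
  change (∃ w, _) ↔ _
  simp only [key]
  constructor
  · rintro ⟨w, h, rfl⟩
    exact h
  · intro h
    exact ⟨_, h, rfl⟩

/-! ### Integrals over affine subspaces and differentiation under the integral -/

theorem exists_norm_fderiv_le {E : Type*} [NormedAddCommGroup E] [NormedSpace ℝ E] (f : SchwartzMap E ℂ) (k : ℕ) :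
    ∃ C, 0 ≤ C ∧ ∀ v, (1 + ‖v‖) ^ k * ‖fderiv ℝ f v‖ ≤ C := by
  have h := fun v => SchwartzMap.one_add_le_sup_seminorm_apply (𝕜 := ℝ) (m := (k, 1))
    le_rfl le_rfl f v
  simp only [norm_iteratedFDeriv_one] at h
  exact ⟨_, le_trans (by positivity) (h 0), h⟩

section Integral

variable {E : Type*} [NormedAddCommGroup E] [InnerProductSpace ℝ E] [FiniteDimensional ℝ E]
  [MeasurableSpace E] [BorelSpace E]

/-- Translation invariance of Lebesgue measure on the direction makes the chosen base point
irrelevant. -/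
theorem integralOver_eq (f : E → ℂ) {L : AffineSubspace ℝ E} {v : E} (hv : v ∈ L) :
    integralOver f L = ∫ u : L.direction, f (u + v) := by
  have hL : (L : Set E).Nonempty := ⟨v, hv⟩
  rw [integralOver, dif_pos hL, OrthonormalBasis.addHaar_eq_volume]
  have hd : hL.some - v ∈ L.direction := AffineSubspace.vsub_mem_direction hL.some_mem hv
  rw [← integral_add_right_eq_self (fun u : L.direction => f (u + v)) ⟨_, hd⟩]
  refine integral_congr_ae (Filter.Eventually.of_forall fun u => ?_)
  change f _ = f _
  congr 1
  simp [add_assoc]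

theorem integralOver_congr {f g : E → ℂ} {L : AffineSubspace ℝ E} (h : ∀ v ∈ L, f v = g v) :
    integralOver f L = integralOver g L := by
  by_cases hL : (L : Set E).Nonempty
  · obtain ⟨v, hv⟩ := hL
    rw [integralOver_eq f hv, integralOver_eq g hv]
    refine integral_congr_ae (Filter.Eventually.of_forall fun u => h _ ?_)
    exact AffineSubspace.vadd_mem_of_mem_direction u.2 hv
  · rw [integralOver, integralOver, dif_neg hL, dif_neg hL]

theorem integral_submodule_map (f : E → ℂ) (e : E ≃ₗᵢ[ℝ] E) {V W : Submodule ℝ E}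
    (h : W = V.map (e : E →ₗ[ℝ] E)) : ∫ w : W, f w = ∫ v : V, f (e v) := by
  subst h
  have key := (LinearIsometryEquiv.submoduleMap V e).measurePreserving.integral_comp
    (LinearIsometryEquiv.submoduleMap V e).toHomeomorph.measurableEmbedding (fun w => f w)
  rw [← key]
  rfl

theorem integralOver_isometry (f : E → ℂ) {L L' : AffineSubspace ℝ E} (e : E ≃ₗᵢ[ℝ] E) (b : E)
    (h : ∀ v, v ∈ L ↔ e v + b ∈ L') :
    integralOver f L' = integralOver (fun v => f (e v + b)) L := by
  have h' : ∀ w, w ∈ L' ↔ e.symm (w - b) ∈ L := fun w => by simp [h]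
  by_cases hL : (L : Set E).Nonempty
  · obtain ⟨v, hv⟩ := hL
    have hv' := (h v).1 hv
    have hd : L'.direction = L.direction.map (e : E →ₗ[ℝ] E) := by
      ext w
      rw [← AffineSubspace.vadd_mem_iff_mem_direction w hv', Submodule.mem_map]
      constructor
      · intro hw
        refine ⟨e.symm w, ?_, by simp⟩
        rw [← AffineSubspace.vadd_mem_iff_mem_direction _ hv, h]
        simpa [add_assoc] using hw
      · rintro ⟨u, hu, rfl⟩
        rw [← AffineSubspace.vadd_mem_iff_mem_direction _ hv, h] at hu
        simpa [add_assoc] using hu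
    rw [integralOver_eq f hv', integralOver_eq _ hv,
      integral_submodule_map (fun w => f (w + (e v + b))) e hd]
    simp [add_assoc]
  · have hL' : ¬(L' : Set E).Nonempty := by
      rintro ⟨w, hw⟩
      exact hL ⟨_, (h' w).1 hw⟩
    rw [integralOver, integralOver, dif_neg hL, dif_neg hL']

theorem integrable_subtype_add (f : SchwartzMap E ℂ) (W : Submodule ℝ E) (v : E) :
    Integrable (fun u : W => f (u + v)) := by
  have ha : AntilipschitzWith 1 (fun u : W => (u : E) + v) := fun x y => by
    simp [edist_dist, dist_eq_norm]
  have hg : (fun u : W => (u : E) + v).HasTemperateGrowth :=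
    W.subtypeL.hasTemperateGrowth.add (.const v)
  exact (SchwartzMap.compCLMOfAntilipschitz ℂ hg ha f).integrable

/-- The integral of a Schwartz function over an affine subspace, as a linear functional. -/
noncomputable def integralOverLM (L : AffineSubspace ℝ E) : SchwartzMap E ℂ →ₗ[ℂ] ℂ where
  toFun f := integralOver f L
  map_add' f g := by
    by_cases hL : (L : Set E).Nonempty
    · obtain ⟨v, hv⟩ := hL
      simp only [integralOver_eq _ hv, _root_.add_apply]
      exact integral_add (integrable_subtype_add f _ v) (integrable_subtype_add g _ v)
    · simp [integralOver, dif_neg hL]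
  map_smul' c f := by
    by_cases hL : (L : Set E).Nonempty
    · obtain ⟨v, hv⟩ := hL
      simp only [integralOver_eq _ hv, _root_.smul_apply, RingHom.id_apply]
      exact integral_smul c _
    · simp [integralOver, dif_neg hL]

/-- Dominated differentiation. Since each `A s` is an isometry, the moving point stays comparable in
size to `u` uniformly for small `s`, so the decay of the derivative of `f` gives one integrable
bound. -/
theorem hasDerivAt_integralOver (f : SchwartzMap E ℂ) (L : AffineSubspace ℝ E)
    (A : ℝ → E ≃ₗᵢ[ℝ] E) (X : E →L[ℝ] E) (b : E) (hA0 : ∀ v, A 0 v = v)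
    (hA : ∀ s v, HasDerivAt (fun s => A s v) (X (A s v)) s) :
    HasDerivAt (fun s : ℝ => integralOver (fun v => f (A s v + s • b)) L)
      (integralOver (fun v => fderiv ℝ f v (X v + b)) L) 0 := by
  by_cases hL : (L : Set E).Nonempty
  swap
  · simp only [integralOver, dif_neg hL]
    exact hasDerivAt_const _ _
  obtain ⟨v, hv⟩ := hL
  simp only [integralOver_eq _ hv]
  set W := L.direction
  -- An exponent above `dim W` makes `(1 + ‖u‖)^(-k)` integrable. One further power of decay, hence
  -- `k + 1`, pays for the linear growth of the field `X v + b`.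
  set k : ℕ := Module.finrank ℝ W + 1
  obtain ⟨C, hC, hf⟩ := exists_norm_fderiv_le f (k + 1)
  set D : ℝ := 1 + ‖b‖ + ‖v‖
  have hD : 1 ≤ D := by
    have := norm_nonneg b
    have := norm_nonneg v
    simp only [D]
    linarith
  have hb : ‖b‖ ≤ D := by
    have := norm_nonneg v
    simp only [D]
    linarith
  set F' : ℝ → W → ℂ := fun s u => fderiv ℝ f (A s (u + v) + s • b) (X (A s (u + v)) + b)
  have hbound : ∀ u : W, ∀ s ∈ Metric.ball (0 : ℝ) 1,
      ‖F' s u‖ ≤ C * (2 * D) ^ (k + 1) * (‖X‖ + D) * (2 * D) * (1 + ‖u‖) ^ (-(k : ℝ)) := by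
    intro u s hs
    have hs1 : |s| ≤ 1 := by
      rw [Metric.mem_ball, dist_zero_right, Real.norm_eq_abs] at hs
      exact hs.le
    set w := A s (u + v) + s • b
    have hsb : ‖s • b‖ ≤ ‖b‖ := by
      rw [norm_smul, Real.norm_eq_abs]
      exact mul_le_of_le_one_left (norm_nonneg _) hs1
    have huv : ‖(u : E)‖ ≤ ‖(u : E) + v‖ + ‖v‖ := by
      simpa using norm_sub_le ((u : E) + v) v
    have hAw : ‖(u : E) + v‖ ≤ ‖w‖ + ‖b‖ := by
      have h1 : ‖A s (u + v)‖ = ‖(u : E) + v‖ := (A s).norm_map _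
      have h2 := norm_sub_le w (s • b)
      rw [show w - s • b = A s (u + v) by simp [w], h1] at h2
      linarith
    have hu0 : ‖u‖ = ‖(u : E)‖ := rfl
    have h1 : 1 + ‖u‖ ≤ 2 * D * (1 + ‖w‖) := by
      have := norm_nonneg w
      have h3 : ‖w‖ ≤ D * ‖w‖ := le_mul_of_one_le_left this hD
      rw [hu0]
      simp only [D] at h3 ⊢
      nlinarith [norm_nonneg b, norm_nonneg v]
    have h2 : ‖X (A s (u + v)) + b‖ ≤ (‖X‖ + D) * (2 * D) * (1 + ‖u‖) := by
      have h3 : ‖X (A s (u + v))‖ ≤ ‖X‖ * ‖(u : E) + v‖ := by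
        simpa only [LinearIsometryEquiv.norm_map] using X.le_opNorm (A s (u + v))
      have h4 : ‖(u : E) + v‖ ≤ 2 * D * (1 + ‖u‖) := by
        have := norm_add_le (u : E) v
        rw [hu0]
        simp only [D]
        nlinarith [norm_nonneg b, norm_nonneg v, norm_nonneg (u : E)]
      have h5 : ‖b‖ ≤ D * (2 * D * (1 + ‖u‖)) := by
        refine hb.trans (le_mul_of_one_le_right (by linarith) ?_)
        nlinarith [norm_nonneg u]
      calc ‖X (A s (u + v)) + b‖ ≤ ‖X‖ * (2 * D * (1 + ‖u‖)) + D * (2 * D * (1 + ‖u‖)) := by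
            refine (norm_add_le _ _).trans (add_le_add (h3.trans ?_) h5)
            exact mul_le_mul_of_nonneg_left h4 (norm_nonneg _)
        _ = _ := by ring
    have hu1 : 0 < 1 + ‖u‖ := by positivity
    have h3 : ‖fderiv ℝ f w‖ * (1 + ‖u‖) ^ (k + 1) ≤ C * (2 * D) ^ (k + 1) := by
      calc ‖fderiv ℝ f w‖ * (1 + ‖u‖) ^ (k + 1)
          ≤ ‖fderiv ℝ f w‖ * (2 * D * (1 + ‖w‖)) ^ (k + 1) := by gcongr
        _ = ((1 + ‖w‖) ^ (k + 1) * ‖fderiv ℝ f w‖) * (2 * D) ^ (k + 1) := by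
          rw [mul_pow]
          ring
        _ ≤ _ := by
          have := hf w
          gcongr
    rw [Real.rpow_neg hu1.le, Real.rpow_natCast, ← div_eq_mul_inv, le_div_iff₀ (by positivity)]
    calc ‖F' s u‖ * (1 + ‖u‖) ^ k
        ≤ ‖fderiv ℝ f w‖ * ((‖X‖ + D) * (2 * D) * (1 + ‖u‖)) * (1 + ‖u‖) ^ k := by
          gcongr
          exact ((fderiv ℝ f w).le_opNorm _).trans (mul_le_mul_of_nonneg_left h2 (norm_nonneg _))
      _ = (‖fderiv ℝ f w‖ * (1 + ‖u‖) ^ (k + 1)) * ((‖X‖ + D) * (2 * D)) := by ring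
      _ ≤ (C * (2 * D) ^ (k + 1)) * ((‖X‖ + D) * (2 * D)) := by
          gcongr
      _ = _ := by ring
  have hfd : Continuous (fderiv ℝ f) := (SchwartzMap.fderivCLM ℝ E ℂ f).continuous
  have key := (hasDerivAt_integral_of_dominated_loc_of_deriv_le (μ := (volume : Measure W))
    (F := fun (s : ℝ) (u : W) => f (A s (u + v) + s • b)) (F' := F') (x₀ := 0)
    (Metric.ball_mem_nhds 0 one_pos) ?_ ?_ ?_ (Filter.Eventually.of_forall hbound) ?_ ?_).2
  · refine key.congr_deriv (integral_congr_ae (Filter.Eventually.of_forall fun u => ?_))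
    simp [F', hA0]
  · refine Filter.Eventually.of_forall fun s => Continuous.aestronglyMeasurable ?_
    have := (A s).continuous
    have := f.continuous
    fun_prop
  · simpa [hA0] using integrable_subtype_add f W v
  · refine Continuous.aestronglyMeasurable ?_
    have := (A 0).continuous
    exact (hfd.comp (by fun_prop)).clm_apply (by fun_prop)
  · refine (integrable_one_add_norm ?_).const_mul _
    simp [k]
  · refine Filter.Eventually.of_forall fun u s _ => ?_
    have h1 : HasDerivAt (fun s : ℝ => A s (u + v) + s • b) (X (A s (u + v)) + b) s := by
      simpa only [one_smul, id_eq] using (hA s (u + v)).fun_add ((hasDerivAt_id s).smul_const b)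
    exact (f.hasFDerivAt _).comp_hasDerivAt s h1

end Integral

/-! ### Symmetric matrices, the locus, and its motion under the unitary group -/

/-- The symmetric part of a matrix, as a function of unordered pairs of indices. -/
noncomputable def symPart : Matrix (Fin n) (Fin n) ℂ →ₗ[ℂ] (Sym2 (Fin n) → ℂ) where
  toFun A := Sym2.lift ⟨fun i j => (A i j + A j i) / 2, fun i j => congrArg (· / 2) (add_comm _ _)⟩
  map_add' A B := by
    funext z
    induction z with
    | _ i j =>
      simp only [Sym2.lift_mk, Matrix.add_apply, Pi.add_apply]
      ring
  map_smul' c A := by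
    funext z
    induction z with
    | _ i j =>
      simp only [Sym2.lift_mk, Matrix.smul_apply, Pi.smul_apply, smul_eq_mul, RingHom.id_apply]
      ring

theorem symPart_mk (A : Matrix (Fin n) (Fin n) ℂ) (i j : Fin n) :
    symPart A s(i, j) = (A i j + A j i) / 2 := rfl

theorem symPart_transpose (A : Matrix (Fin n) (Fin n) ℂ) : symPart Aᵀ = symPart A := by
  funext z
  induction z with
  | _ i j => rw [symPart_mk, symPart_mk, Matrix.transpose_apply, Matrix.transpose_apply, add_comm]

theorem mat_symPart {A : Matrix (Fin n) (Fin n) ℂ} (hA : Aᵀ = A) (σ : Fin n → ℂ) :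
    SymmSpace.mat (symPart A, σ) = A := by
  ext i j
  have h : A j i = A i j := congrFun (congrFun hA i) j
  change (A i j + A j i) / 2 = A i j
  rw [h]
  ring

theorem mat_transpose (p : SymmSpace n) : p.matᵀ = p.mat := by
  ext i j
  exact congrArg p.1 Sym2.eq_swap

theorem symPart_mat (p : SymmSpace n) : symPart p.mat = p.1 := by
  funext z
  induction z with
  | _ i j =>
    have h : p.mat j i = p.mat i j := congrFun (congrFun (mat_transpose p) i) j
    rw [symPart_mk, h]
    change (p.1 s(i, j) + p.1 s(i, j)) / 2 = _
    ring

/-- In this form the two conditions say that `h ↦ S h̄ + σ` is an involution; the Lagrangian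
subspace is its fixed set. -/
theorem mem_lagrangianLocus_iff {p : SymmSpace n} :
    p ∈ lagrangianLocus n ↔ p.mat * p.matᴴ = 1 ∧ p.mat *ᵥ star p.vec = -p.vec := by
  refine and_congr_right fun h => ?_
  have h1 : p.mat⁻¹ = p.matᴴ := Matrix.inv_eq_right_inv h
  have h2 : p.matᴴ * p.mat = 1 := mul_eq_one_comm.1 h
  rw [h1]
  constructor
  · intro e
    rw [e, Matrix.mulVec_neg, Matrix.mulVec_mulVec, h, Matrix.one_mulVec]
  · intro e
    rw [← Matrix.mulVec_neg, ← e, Matrix.mulVec_mulVec, h2, Matrix.one_mulVec]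

section

open scoped Matrix.Norms.L2Operator

theorem exists_unitary_curve {X : Matrix (Fin n) (Fin n) ℂ} (hX : Xᴴ = -X) :
    ∃ U : ℝ → Matrix (Fin n) (Fin n) ℂ, U 0 = 1 ∧ (∀ s, (U s)ᴴ * U s = 1) ∧
      ∀ s, HasDerivAt U (X * U s) s := by
  refine ⟨fun s => NormedSpace.exp (s • X), by simp, fun s => ?_, fun s =>
    hasDerivAt_exp_smul_const' X s⟩
  have h : s • X ∈ skewAdjoint (Matrix (Fin n) (Fin n) ℂ) := by
    rw [skewAdjoint.mem_iff, Matrix.star_eq_conjTranspose, Matrix.conjTranspose_smul, hX]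
    simp
  let : NormedAlgebra ℚ (Matrix (Fin n) (Fin n) ℂ) := NormedAlgebra.restrictScalars ℚ ℂ _
  exact (Unitary.mem_iff.1 (NormedSpace.exp_mem_unitary_of_mem_skewAdjoint h)).1

/-- The function `s ↦ G (q s)` is differentiated at 0 in two ways: by the chain rule, and under the
integral after moving the subspace back by an isometry. The factor 2 arises because `X S + S Xᵀ` is
twice the symmetric part of `X S`. -/
theorem fderiv_eq_integralOver_of_skew (f : SchwartzMap (PhaseSpace n) ℂ) {G : SymmSpace n → ℂ}
    {p : SymmSpace n} (hp : p ∈ lagrangianLocus n) (hG : DifferentiableAt ℂ G p)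
    (hext : ∀ q ∈ lagrangianLocus n, G q = radonComp f q)
    {X : Matrix (Fin n) (Fin n) ℂ} (hX : Xᴴ = -X) (c : Fin n → ℂ) :
    fderiv ℂ G p ((2 : ℂ) • symPart (X * p.mat), X *ᵥ p.vec + c - p.mat *ᵥ star c) =
      integralOver (fun v => fderiv ℝ f v (ofHolo (X *ᵥ holo v + c))) (affineLagrangian p) := by
  obtain ⟨U, hU0, hU, hU'⟩ := exists_unitary_curve hX
  obtain ⟨hS, hσ⟩ := mem_lagrangianLocus_iff.1 hp
  set S := p.mat
  set σ := p.vec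
  have hSt : Sᵀ = S := mat_transpose p
  have hUt : ∀ s, U s * (U s)ᴴ = 1 := fun s => mul_eq_one_comm.1 (hU s)
  have hUc : ∀ s, (U s)ᵀ * (U s)ᴴᵀ = 1 := fun s => by
    rw [← Matrix.transpose_mul, hU, Matrix.transpose_one]
  set Q : ℝ → Matrix (Fin n) (Fin n) ℂ := fun s => U s * S * (U s)ᵀ
  -- These coordinates result from substituting `h' = U h + s c` into `h = S h̄ + σ` and solving for
  -- `h'` in terms of its conjugate.
  set q : ℝ → SymmSpace n := fun s =>
    (symPart (Q s), U s *ᵥ σ + s • (c - Q s *ᵥ star c))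
  have hQt : ∀ s, (Q s)ᵀ = Q s := fun s => by
    simp only [Q, Matrix.transpose_mul, Matrix.transpose_transpose, hSt, Matrix.mul_assoc]
  have hmat : ∀ s, (q s).mat = Q s := fun s => mat_symPart (hQt s) _
  have hvec : ∀ s, (q s).vec = U s *ᵥ σ + s • (c - Q s *ᵥ star c) := fun s => rfl
  have hq0 : q 0 = p := by
    simp only [q, Q, hU0, Matrix.one_mul, Matrix.transpose_one, Matrix.mul_one, zero_smul,
      add_zero, Matrix.one_mulVec]
    exact Prod.ext (symPart_mat p) rfl
  have hQU : ∀ s, Q s * (U s)ᴴᵀ = U s * S := fun s => by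
    simp only [Q]
    rw [Matrix.mul_assoc, hUc, Matrix.mul_one]
  have hstar : ∀ (s : ℝ) (a : Fin n → ℂ), star (U s *ᵥ a) = (U s)ᴴᵀ *ᵥ star a := fun s a => by
    rw [Matrix.star_mulVec, Matrix.mulVec_transpose]
  have hQQ : ∀ s, Q s * (Q s)ᴴ = 1 := fun s => by
    have e : (Q s)ᴴ = (U s)ᴴᵀ * Sᴴ * (U s)ᴴ := by
      simp only [Q, Matrix.conjTranspose_mul, Matrix.mul_assoc]
      rfl
    rw [e, ← Matrix.mul_assoc, ← Matrix.mul_assoc, hQU, Matrix.mul_assoc (U s), hS,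
      Matrix.mul_one, hUt]
  have hQc : ∀ s, star (Q s *ᵥ star c) = (Q s)ᴴ *ᵥ c := fun s => by
    rw [Matrix.star_mulVec, star_star, ← Matrix.mulVec_transpose]
    congr 1
    change (Q s)ᵀᴴ = _
    rw [hQt]
  have hqM : ∀ s, q s ∈ lagrangianLocus n := fun s => by
    rw [mem_lagrangianLocus_iff, hmat, hvec]
    refine ⟨hQQ s, ?_⟩
    rw [star_add, star_smul, star_sub, hstar, hQc, Matrix.mulVec_add, Matrix.mulVec_mulVec, hQU,
      ← Matrix.mulVec_mulVec, hσ, star_trivial s, Matrix.mulVec_smul, Matrix.mulVec_sub,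
      Matrix.mulVec_mulVec, hQQ, Matrix.one_mulVec, Matrix.mulVec_neg]
    module
  have hQ' : HasDerivAt Q (X * S + S * Xᵀ) 0 := by
    have hT : HasDerivAt (fun s => (U s)ᵀ) (Xᵀ) 0 := by
      have := ((Matrix.transposeLinearEquiv (Fin n) (Fin n) ℝ ℂ).toLinearMap.toContinuousLinearMap.hasFDerivAt
        (x := U 0)).comp_hasDerivAt 0 (hU' 0)
      simpa [hU0] using! this
    have := ((hU' 0).mul_const S).mul hT
    simpa [hU0] using! this
  have hq' : HasDerivAt q ((2 : ℂ) • symPart (X * S), X *ᵥ σ + c - S *ᵥ star c) 0 := by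
    refine HasDerivAt.prodMk ?_ ?_
    · have := ((symPart (n := n)).toContinuousLinearMap.hasFDerivAt.restrictScalars ℝ
        (x := Q 0)).comp_hasDerivAt 0 hQ'
      refine this.congr_deriv ?_
      have e : symPart (S * Xᵀ) = symPart (X * S) := by
        rw [← symPart_transpose (X * S), Matrix.transpose_mul, hSt]
      change symPart (X * S + S * Xᵀ) = _
      rw [map_add, e, two_smul]
    · have hv : ∀ (B : ℝ → Matrix (Fin n) (Fin n) ℂ) (B' : Matrix (Fin n) (Fin n) ℂ)
          (a : Fin n → ℂ), HasDerivAt B B' 0 →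
          HasDerivAt (fun s => B s *ᵥ a) (B' *ᵥ a) 0 := fun B B' a hB =>
        ((((Matrix.mulVecBilin ℂ ℂ).flip a).toContinuousLinearMap.hasFDerivAt.restrictScalars ℝ
          (x := B 0)).comp_hasDerivAt 0 hB)
      have h1 := (hv U _ σ (hU' 0)).fun_add
        ((hasDerivAt_id (0 : ℝ)).fun_smul (((hv Q _ (star c) hQ').const_sub c)))
      refine h1.congr_deriv ?_
      simp only [hU0, Matrix.mul_one, id_eq, zero_smul, one_smul, zero_add, Q, Matrix.one_mul,
        Matrix.transpose_one]
      abel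
  have hL : HasDerivAt (fun s => G (q s))
      (fderiv ℂ G p ((2 : ℂ) • symPart (X * S), X *ᵥ σ + c - S *ᵥ star c)) 0 := by
    have hG' : HasFDerivAt G ((fderiv ℂ G p).restrictScalars ℝ) (q 0) := by
      rw [hq0]
      exact hG.hasFDerivAt.restrictScalars ℝ
    exact hG'.comp_hasDerivAt 0 hq'
  set XO : PhaseSpace n →L[ℝ] PhaseSpace n := ofHolo ∘L
    ((Matrix.mulVecLin X).restrictScalars ℝ).toContinuousLinearMap ∘L holo
  have hXO : ∀ v, XO v = ofHolo (X *ᵥ holo v) := fun v => rfl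
  have hR := hasDerivAt_integralOver f (affineLagrangian p) (fun s => rotation (U s) (hU s)) XO
    (ofHolo c) (fun v => by rw [rotation_apply, hU0, Matrix.one_mulVec, ofHolo_holo])
    (fun s v => by
      have := ((ofHolo ∘L (((Matrix.mulVecBilin ℂ ℂ).flip
        (holo v)).restrictScalars ℝ).toContinuousLinearMap).hasFDerivAt (x := U s)).comp_hasDerivAt
          s (hU' s)
      refine this.congr_deriv ?_
      rw [hXO, rotation_apply, holo_ofHolo, Matrix.mulVec_mulVec]
      rfl)
  have hGq : (fun s => G (q s)) = fun s : ℝ => integralOver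
      (fun v => f (rotation (U s) (hU s) v + s • ofHolo c)) (affineLagrangian p) := by
    funext s
    rw [hext _ (hqM s), radonComp]
    refine integralOver_isometry _ _ _ fun v => ?_
    rw [mem_affineLagrangian, mem_affineLagrangian, hmat, hvec, rotation_apply, map_add,
      map_smul, holo_ofHolo, holo_ofHolo, star_add, hstar, Matrix.mulVec_add,
      Matrix.mulVec_mulVec, hQU, star_smul, star_trivial s, Matrix.mulVec_smul]
    have e : (U s * S) *ᵥ star (holo v) + s • Q s *ᵥ star c + (U s *ᵥ σ + s • (c - Q s *ᵥ star c))
        = U s *ᵥ (S *ᵥ star (holo v) + σ) + s • c := by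
      rw [Matrix.mulVec_add, Matrix.mulVec_mulVec]
      module
    rw [e, add_left_inj]
    refine ⟨fun h => congrArg _ h, fun h => ?_⟩
    have := congrArg ((U s)ᴴ *ᵥ ·) h
    simpa only [Matrix.mulVec_mulVec, hU, Matrix.one_mulVec] using this
  rw [hGq] at hL
  rw [hL.unique hR]
  simp only [hXO, ← map_add]

end

/-! ### Multiplication operators and Wirtinger derivatives on Schwartz functions -/

/-- Multiplication by a complex coordinate. -/
noncomputable def holoMul (k : Fin n) : Module.End ℂ (SchwartzMap (PhaseSpace n) ℂ) :=
  (SchwartzMap.smulLeftCLM ℂ (fun v : PhaseSpace n => holo v k)).toLinearMap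

/-- Multiplication by the conjugate of a complex coordinate. -/
noncomputable def conjMul (k : Fin n) : Module.End ℂ (SchwartzMap (PhaseSpace n) ℂ) :=
  (SchwartzMap.smulLeftCLM ℂ (fun v : PhaseSpace n => star (holo v k))).toLinearMap

/-- The Wirtinger derivative with respect to a complex coordinate. -/
noncomputable def dHolo (k : Fin n) : Module.End ℂ (SchwartzMap (PhaseSpace n) ℂ) :=
  (1 / 2 : ℂ) • ((LineDeriv.lineDerivOpCLM ℂ (SchwartzMap (PhaseSpace n) ℂ)
      (ofHolo (Pi.single k 1))).toLinearMap -
    I • (LineDeriv.lineDerivOpCLM ℂ (SchwartzMap (PhaseSpace n) ℂ)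
      (ofHolo (Pi.single k I))).toLinearMap)

/-- The Wirtinger derivative with respect to the conjugate of a complex coordinate. -/
noncomputable def dConj (k : Fin n) : Module.End ℂ (SchwartzMap (PhaseSpace n) ℂ) :=
  (1 / 2 : ℂ) • ((LineDeriv.lineDerivOpCLM ℂ (SchwartzMap (PhaseSpace n) ℂ)
      (ofHolo (Pi.single k 1))).toLinearMap +
    I • (LineDeriv.lineDerivOpCLM ℂ (SchwartzMap (PhaseSpace n) ℂ)
      (ofHolo (Pi.single k I))).toLinearMap)

/-- A complex coordinate, as a linear functional. -/
noncomputable def holoCLM (k : Fin n) : PhaseSpace n →L[ℝ] ℂ :=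
  ContinuousLinearMap.proj k ∘L holo

theorem holoMul_apply (k : Fin n) (f : SchwartzMap (PhaseSpace n) ℂ) (v : PhaseSpace n) :
    holoMul k f v = holo v k * f v :=
  SchwartzMap.smulLeftCLM_apply_apply (holoCLM k).hasTemperateGrowth f v

theorem conjMul_apply (k : Fin n) (f : SchwartzMap (PhaseSpace n) ℂ) (v : PhaseSpace n) :
    conjMul k f v = star (holo v k) * f v :=
  SchwartzMap.smulLeftCLM_apply_apply
    (conjCLE.toContinuousLinearMap ∘L holoCLM k).hasTemperateGrowth f v

theorem dHolo_apply (k : Fin n) (f : SchwartzMap (PhaseSpace n) ℂ) (v : PhaseSpace n) :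
    dHolo k f v = 1 / 2 * (fderiv ℝ f v (ofHolo (Pi.single k 1)) -
      I * fderiv ℝ f v (ofHolo (Pi.single k I))) := rfl

theorem dConj_apply (k : Fin n) (f : SchwartzMap (PhaseSpace n) ℂ) (v : PhaseSpace n) :
    dConj k f v = 1 / 2 * (fderiv ℝ f v (ofHolo (Pi.single k 1)) +
      I * fderiv ℝ f v (ofHolo (Pi.single k I))) := rfl

theorem fderiv_ofHolo (f : SchwartzMap (PhaseSpace n) ℂ) (v : PhaseSpace n) (a : Fin n → ℂ) :
    fderiv ℝ f v (ofHolo a) = ∑ k, (a k * dHolo k f v + star (a k) * dConj k f v) := by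
  have e : a = ∑ k, ((a k).re • (Pi.single k 1 : Fin n → ℂ) +
      (a k).im • (Pi.single k I : Fin n → ℂ)) := by
    funext i
    simp only [Finset.sum_apply, Pi.add_apply, Pi.smul_apply, Pi.single_apply, smul_ite, smul_zero,
      Finset.sum_add_distrib, Finset.sum_ite_eq, Finset.mem_univ, if_true, real_smul, mul_one]
    exact (re_add_im _).symm
  conv_lhs => rw [e]
  simp only [map_sum, map_add, map_smul]
  refine Finset.sum_congr rfl fun k _ => ?_
  rw [dHolo_apply, dConj_apply, real_smul, real_smul]
  have h1 : star (a k) = (a k).re - (a k).im * I := by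
    apply Complex.ext <;> simp
  rw [h1]
  nth_rewrite 3 [← re_add_im (a k)]
  linear_combination ((a k).im * fderiv ℝ f v (ofHolo (Pi.single k I))) * I_mul_I

theorem fderiv_conjMul (i : Fin n) (f : SchwartzMap (PhaseSpace n) ℂ) (v : PhaseSpace n)
    (a : Fin n → ℂ) :
    fderiv ℝ (conjMul i f) v (ofHolo a) =
      star (holo v i) * fderiv ℝ f v (ofHolo a) + star (a i) * f v := by
  have h1 : HasFDerivAt (fun v : PhaseSpace n => star (holo v i))
      (conjCLE.toContinuousLinearMap ∘L holoCLM i) v :=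
    (conjCLE.toContinuousLinearMap ∘L holoCLM i).hasFDerivAt
  have h2 := h1.mul (f.hasFDerivAt v)
  have e : (conjMul i f : PhaseSpace n → ℂ) =
      (fun v : PhaseSpace n => star (holo v i)) * f := funext fun v => conjMul_apply i f v
  rw [e, h2.fderiv]
  have h3 : (conjCLE.toContinuousLinearMap ∘L holoCLM i) (ofHolo a) = star (a i) := by
    change star (holo (ofHolo a) i) = _
    rw [holo_ofHolo]
  simp only [_root_.add_apply, _root_.smul_apply, smul_eq_mul, h3]
  ring

theorem dHolo_conjMul (k i : Fin n) (f : SchwartzMap (PhaseSpace n) ℂ) :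
    dHolo k (conjMul i f) = conjMul i (dHolo k f) := by
  ext v
  rw [dHolo_apply, fderiv_conjMul, fderiv_conjMul, conjMul_apply, dHolo_apply]
  by_cases h : i = k
  · subst h
    simp only [Pi.single_eq_same, RCLike.star_def, conj_I, map_one]
    linear_combination (1 / 2 * f v) * I_mul_I
  · simp only [Pi.single_eq_of_ne h, star_zero]
    ring

theorem dConj_conjMul (k i : Fin n) (f : SchwartzMap (PhaseSpace n) ℂ) :
    dConj k (conjMul i f) = conjMul i (dConj k f) + (if i = k then (1 : ℂ) else 0) • f := by
  ext v
  rw [dConj_apply, fderiv_conjMul, fderiv_conjMul, _root_.add_apply, conjMul_apply, dConj_apply,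
    _root_.smul_apply, smul_eq_mul]
  by_cases h : i = k
  · subst h
    simp only [Pi.single_eq_same, RCLike.star_def, conj_I, map_one, if_true]
    linear_combination (-1 / 2 * f v) * I_mul_I
  · simp only [Pi.single_eq_of_ne h, star_zero, if_neg h]
    ring

theorem lineDerivOp_commute (f : SchwartzMap (PhaseSpace n) ℂ) (a b : PhaseSpace n) :
    ∂_{a} (∂_{b} f) = ∂_{b} (∂_{a} f) := by
  have h : ∀ (a b v : PhaseSpace n), ∂_{a} (∂_{b} f) v = fderiv ℝ (fderiv ℝ f) v a b := by
    intro a b v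
    have hd : HasFDerivAt (fderiv ℝ f) (fderiv ℝ (fderiv ℝ f) v) v :=
      (SchwartzMap.fderivCLM ℝ _ ℂ f).hasFDerivAt v
    change fderiv ℝ (fun w => fderiv ℝ f w b) v a = _
    rw [(hd.clm_apply (hasFDerivAt_const b v)).fderiv]
    simp
  ext v
  rw [h, h]
  have := ((f.smooth 2).contDiffAt (x := v)).isSymmSndFDerivAt (by simp)
  exact this a b

theorem dHolo_dHolo (k l : Fin n) (f : SchwartzMap (PhaseSpace n) ℂ) :
    dHolo k (dHolo l f) = dHolo l (dHolo k f) := by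
  have h : ∀ k l, dHolo k (dHolo l f) = (1 / 2 : ℂ) • (1 / 2 : ℂ) •
      ((∂_{ofHolo (Pi.single k 1)} (∂_{ofHolo (Pi.single l 1)} f) -
        I • ∂_{ofHolo (Pi.single k 1)} (∂_{ofHolo (Pi.single l I)} f)) -
      I • (∂_{ofHolo (Pi.single k I)} (∂_{ofHolo (Pi.single l 1)} f) -
        I • ∂_{ofHolo (Pi.single k I)} (∂_{ofHolo (Pi.single l I)} f))) := by
    intro k l
    simp only [dHolo, LinearMap.smul_apply, LinearMap.sub_apply, ContinuousLinearMap.coe_coe,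
      map_smul, map_sub, LineDeriv.lineDerivOpCLM_apply]
    module
  rw [h, h, lineDerivOp_commute f (ofHolo (Pi.single k 1)) (ofHolo (Pi.single l 1)),
    lineDerivOp_commute f (ofHolo (Pi.single k 1)) (ofHolo (Pi.single l I)),
    lineDerivOp_commute f (ofHolo (Pi.single k I)) (ofHolo (Pi.single l 1)),
    lineDerivOp_commute f (ofHolo (Pi.single k I)) (ofHolo (Pi.single l I))]
  module

/-! ### Holomorphic derivatives of `G` at points of the locus -/

/-- The Radon transform at a point, as a linear functional. -/
noncomputable def radonLM (p : SymmSpace n) : SchwartzMap (PhaseSpace n) ℂ →ₗ[ℂ] ℂ :=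
  integralOverLM (affineLagrangian p)

theorem radonLM_apply (p : SymmSpace n) (f : SchwartzMap (PhaseSpace n) ℂ) :
    radonLM p f = radonComp f p := rfl

theorem integralOver_eq_radonLM (p : SymmSpace n) {g : PhaseSpace n → ℂ}
    {f : SchwartzMap (PhaseSpace n) ℂ} (h : ∀ v ∈ affineLagrangian p, g v = f v) :
    integralOver g (affineLagrangian p) = radonLM p f :=
  integralOver_congr h

/-- The derivative in the direction given by complexified coordinates of phase space. -/
noncomputable def dirDeriv (f : SchwartzMap (PhaseSpace n) ℂ) :
    (Fin n → ℂ) × (Fin n → ℂ) →ₗ[ℂ] SchwartzMap (PhaseSpace n) ℂ :=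
  (Fintype.linearCombination ℂ fun k => dHolo k f).coprod
    (Fintype.linearCombination ℂ fun k => dConj k f)

theorem dirDeriv_apply (f : SchwartzMap (PhaseSpace n) ℂ) (c d : Fin n → ℂ) :
    dirDeriv f (c, d) = ∑ k, c k • dHolo k f + ∑ k, d k • dConj k f := rfl

theorem dirDeriv_star (f : SchwartzMap (PhaseSpace n) ℂ) (c : Fin n → ℂ) (v : PhaseSpace n) :
    dirDeriv f (c, star c) v = fderiv ℝ f v (ofHolo c) := by
  rw [fderiv_ofHolo, Finset.sum_add_distrib, dirDeriv_apply, _root_.add_apply,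
    _root_.sum_apply, _root_.sum_apply]
  rfl

/-- Derivatives along an affine Lagrangian subspace integrate to zero. -/
theorem radonLM_dirDeriv_tangent (f : SchwartzMap (PhaseSpace n) ℂ) {p : SymmSpace n}
    (hS : p.mat * p.matᴴ = 1) (d : Fin n → ℂ) :
    radonLM p (dirDeriv f (p.mat *ᵥ d, d)) = 0 := by
  have real : ∀ c : Fin n → ℂ, p.mat *ᵥ star c = c →
      radonLM p (dirDeriv f (p.mat *ᵥ star c, star c)) = 0 := by
    intro c hc
    rw [hc]
    have h1 := hasDerivAt_integralOver f (affineLagrangian p)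
      (fun _ => LinearIsometryEquiv.refl ℝ _) 0 (ofHolo c) (fun v => rfl)
      (fun s v => by simpa using hasDerivAt_const s v)
    -- Translation by a vector with `S c̄ = c` preserves the subspace, so the integral is constant
    -- in `s`.
    have h2 : (fun s : ℝ => integralOver
        (fun v => f ((LinearIsometryEquiv.refl ℝ (PhaseSpace n)) v + s • ofHolo c))
        (affineLagrangian p)) = fun _ => integralOver f (affineLagrangian p) := by
      funext s
      refine (integralOver_isometry _ _ _ fun v => ?_).symm
      rw [mem_affineLagrangian, mem_affineLagrangian, LinearIsometryEquiv.coe_refl, id, map_add,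
        map_smul, holo_ofHolo, star_add, Matrix.mulVec_add, star_smul, star_trivial s,
        Matrix.mulVec_smul, hc, add_right_comm, add_left_inj]
    rw [h2] at h1
    rw [← (h1.unique (hasDerivAt_const _ _))]
    refine (integralOver_eq_radonLM p fun v _ => ?_).symm
    rw [dirDeriv_star]
    simp
  have hcc : ∀ a : Fin n → ℂ, p.mat *ᵥ star (p.mat *ᵥ star a) = a := by
    intro a
    have : star (p.mat *ᵥ star a) = p.matᴴ *ᵥ a := by
      rw [Matrix.star_mulVec, star_star, ← Matrix.mulVec_transpose]
      congr 1
      change p.matᵀᴴ = _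
      rw [mat_transpose]
    rw [this, Matrix.mulVec_mulVec, hS, Matrix.one_mulVec]
  set e : Fin n → ℂ := p.mat *ᵥ d
  have hce : p.mat *ᵥ star (star d) = e := by rw [star_star]
  have hee : p.mat *ᵥ star e = star d := by
    rw [← hce]
    exact hcc _
  -- The antilinear involution `c ↦ S c̄` swaps `star d` and `e`. Hence their sum and `i` times
  -- their difference are real tangent vectors, and these two recover `(S d, d)` over ℂ.
  have r1 := real (star d + e) (by
    rw [star_add, Matrix.mulVec_add, hce, hee, add_comm])
  have r2 := real (I • star d - I • e) (by
    rw [star_sub, star_smul, star_smul, Matrix.mulVec_sub, Matrix.mulVec_smul, Matrix.mulVec_smul,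
      hce, hee]
    simp only [RCLike.star_def, conj_I]
    module)
  have hd : ((p.mat *ᵥ d, d) : (Fin n → ℂ) × (Fin n → ℂ)) =
      (1 / 2 : ℂ) • (p.mat *ᵥ star (star d + e), star (star d + e)) +
      (I / 2) • (p.mat *ᵥ star (I • star d - I • e), star (I • star d - I • e)) := by
    have hI : I * I = -1 := I_mul_I
    have h2 : d = (1 / 2 : ℂ) • star (star d + e) + (I / 2) • star (I • star d - I • e) := by
      rw [star_sub, star_smul, star_smul, star_add, star_star]
      simp only [RCLike.star_def, conj_I]
      funext k
      simp only [Pi.add_apply, Pi.smul_apply, Pi.sub_apply, smul_eq_mul]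
      linear_combination (1 / 2 * d k - 1 / 2 * star e k) * hI
    refine Prod.ext ?_ h2
    change p.mat *ᵥ d = (1 / 2 : ℂ) • p.mat *ᵥ star (star d + e) +
      (I / 2) • p.mat *ᵥ star (I • star d - I • e)
    rw [← Matrix.mulVec_smul, ← Matrix.mulVec_smul, ← Matrix.mulVec_add, ← h2]
  rw [hd, map_add, map_smul, map_smul, map_add, map_smul, map_smul, r1, r2, smul_zero, smul_zero,
    add_zero]

variable {f : SchwartzMap (PhaseSpace n) ℂ} {G : SymmSpace n → ℂ} {p : SymmSpace n}

/-- Real translations give the identity for the pair `(c, c̄)`. Combining the cases `c` and `i c`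
over ℂ cancels the antilinear parts on both sides, leaving `(c, 0)`. -/
theorem fderiv_vec_eq_radonLM (hp : p ∈ lagrangianLocus n) (hG : DifferentiableAt ℂ G p)
    (hext : ∀ q ∈ lagrangianLocus n, G q = radonComp f q) (c : Fin n → ℂ) :
    fderiv ℂ G p (0, c) = radonLM p (∑ k, c k • dHolo k f) := by
  have real : ∀ c : Fin n → ℂ, fderiv ℂ G p (0, c - p.mat *ᵥ star c) =
      radonLM p (dirDeriv f (c, star c)) := by
    intro c
    have := fderiv_eq_integralOver_of_skew f hp hG hext (X := 0) (by simp) c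
    simp only [Matrix.zero_mul, map_zero, smul_zero, Matrix.zero_mulVec, zero_add] at this
    rw [this]
    exact integralOver_eq_radonLM p fun v _ => (dirDeriv_star f c v).symm
  have r1 := real c
  have r2 := real (I • c)
  have hI : ∀ a : Fin n → ℂ, I • I • a = -a := fun a => by
    rw [smul_smul, I_mul_I, neg_one_smul]
  have e1 : ((0, c) : SymmSpace n) = (1 / 2 : ℂ) • (0, c - p.mat *ᵥ star c) -
      (I / 2) • (0, I • c - p.mat *ᵥ star (I • c)) := by
    refine Prod.ext (by simp) ?_
    change c = (1 / 2 : ℂ) • (c - p.mat *ᵥ star c) - (I / 2) • (I • c - p.mat *ᵥ star (I • c))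
    rw [star_smul, Matrix.mulVec_smul]
    simp only [RCLike.star_def, conj_I]
    funext k
    simp only [Pi.sub_apply, Pi.smul_apply, smul_eq_mul]
    linear_combination (1 / 2 * c k + 1 / 2 * (p.mat *ᵥ star c) k) * I_mul_I
  have e2 : ((c, 0) : (Fin n → ℂ) × (Fin n → ℂ)) = (1 / 2 : ℂ) • (c, star c) -
      (I / 2) • (I • c, star (I • c)) := by
    refine Prod.ext ?_ ?_
    · change c = (1 / 2 : ℂ) • c - (I / 2) • I • c
      funext k
      simp only [Pi.sub_apply, Pi.smul_apply, smul_eq_mul]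
      linear_combination (1 / 2 * c k) * I_mul_I
    · change 0 = (1 / 2 : ℂ) • star c - (I / 2) • star (I • c)
      rw [star_smul]
      simp only [RCLike.star_def, conj_I]
      funext k
      simp only [Pi.sub_apply, Pi.smul_apply, smul_eq_mul, Pi.zero_apply]
      linear_combination (-1 / 2 * star c k) * I_mul_I
  have e3 : ∑ k, c k • dHolo k f = dirDeriv f (c, 0) := by
    simp [dirDeriv_apply]
  rw [e1, e3, e2, map_sub, map_smul, map_smul, r1, r2, map_sub, map_smul, map_smul, map_sub,
    map_smul, map_smul]

/-- The infinitesimal action of a matrix on Schwartz functions. -/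
noncomputable def matDeriv (f : SchwartzMap (PhaseSpace n) ℂ) :
    Matrix (Fin n) (Fin n) ℂ →ₗ[ℂ] SchwartzMap (PhaseSpace n) ℂ where
  toFun X := ∑ k, ∑ l, X k l • (holoMul l (dHolo k f) - conjMul k (dConj l f))
  map_add' X Y := by
    simp only [Matrix.add_apply, add_smul, Finset.sum_add_distrib]
  map_smul' c X := by
    simp only [Matrix.smul_apply, smul_eq_mul, mul_smul, Finset.smul_sum, RingHom.id_apply]

theorem matDeriv_apply (f : SchwartzMap (PhaseSpace n) ℂ) (X : Matrix (Fin n) (Fin n) ℂ) :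
    matDeriv f X = ∑ k, ∑ l, X k l • (holoMul l (dHolo k f) - conjMul k (dConj l f)) := rfl

/-- For skew-Hermitian `X` the conjugate components of the field `h ↦ X h` are `-∑ X_{lk} h̄_l`.
This rewriting removes the conjugation of `X` and makes the action extend complex-linearly. -/
theorem matDeriv_skew {X : Matrix (Fin n) (Fin n) ℂ} (hX : Xᴴ = -X) (v : PhaseSpace n) :
    matDeriv f X v = fderiv ℝ f v (ofHolo (X *ᵥ holo v)) := by
  have hX' : ∀ k l, star (X k l) = -X l k := fun k l => congrFun (congrFun hX l) k
  rw [fderiv_ofHolo, matDeriv_apply, Finset.sum_add_distrib]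
  simp only [_root_.sum_apply, _root_.smul_apply, _root_.sub_apply, smul_eq_mul,
    holoMul_apply, conjMul_apply, Matrix.mulVec, dotProduct, mul_sub, Finset.sum_sub_distrib,
    star_sum, star_mul', hX', Finset.sum_mul]
  rw [sub_eq_add_neg, ← Finset.sum_neg_distrib]
  congr 1
  · exact Finset.sum_congr rfl fun k _ => Finset.sum_congr rfl fun l _ => by ring
  · simp only [← Finset.sum_neg_distrib]
    rw [Finset.sum_comm]
    exact Finset.sum_congr rfl fun k _ => Finset.sum_congr rfl fun l _ => by ring

/-- Both sides are complex-linear in `X`, and skew-Hermitian matrices span all matrices over ℂ. -/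
theorem fderiv_mat_eq_radonLM (hp : p ∈ lagrangianLocus n) (hG : DifferentiableAt ℂ G p)
    (hext : ∀ q ∈ lagrangianLocus n, G q = radonComp f q) (X : Matrix (Fin n) (Fin n) ℂ) :
    fderiv ℂ G p ((2 : ℂ) • symPart (X * p.mat), X *ᵥ p.vec) = radonLM p (matDeriv f X) := by
  set Λ : Matrix (Fin n) (Fin n) ℂ →ₗ[ℂ] SymmSpace n :=
    ((2 : ℂ) • symPart ∘ₗ LinearMap.mulRight ℂ p.mat).prod
      ((Matrix.mulVecBilin ℂ ℂ).flip p.vec)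
  have hΛ : ∀ X, Λ X = ((2 : ℂ) • symPart (X * p.mat), X *ᵥ p.vec) := fun X => rfl
  have real : ∀ X : Matrix (Fin n) (Fin n) ℂ, Xᴴ = -X →
      fderiv ℂ G p (Λ X) = radonLM p (matDeriv f X) := by
    intro X hX
    have := fderiv_eq_integralOver_of_skew f hp hG hext hX 0
    simp only [add_zero, star_zero, Matrix.mulVec_zero, sub_zero] at this
    rw [hΛ, this]
    exact integralOver_eq_radonLM p fun v _ => (matDeriv_skew hX v).symm
  have r1 := real (X - Xᴴ) (by simp)
  have r2 := real (I • X + I • Xᴴ) (by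
    simp only [Matrix.conjTranspose_add, Matrix.conjTranspose_smul,
      Matrix.conjTranspose_conjTranspose, RCLike.star_def, conj_I]
    module)
  have e : X = (1 / 2 : ℂ) • (X - Xᴴ) - (I / 2) • (I • X + I • Xᴴ) := by
    ext i j
    simp only [Matrix.sub_apply, Matrix.smul_apply, Matrix.add_apply, smul_eq_mul]
    linear_combination (1 / 2 * X i j + 1 / 2 * Xᴴ i j) * I_mul_I
  rw [← hΛ]
  rw [e]
  rw [map_sub Λ, map_sub (matDeriv f), map_sub, map_sub]
  simp only [map_smul _ (1 / 2 : ℂ), map_smul _ (I / 2)]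
  rw [r1, r2]

/-! ### The commuting operator matrix and its minors -/

/-- Multiplication by the conjugate coordinate, or by `1` for the index `none`. -/
noncomputable def mulOp : Option (Fin n) → Module.End ℂ (SchwartzMap (PhaseSpace n) ℂ)
  | some i => conjMul i
  | none => 1

/-- The Wirtinger derivative, or `0` for the index `none`. -/
noncomputable def diffOp : Option (Fin n) → Module.End ℂ (SchwartzMap (PhaseSpace n) ℂ)
  | some i => dHolo i
  | none => 0

theorem mulOp_comm (a b : Option (Fin n)) : mulOp a * mulOp b = mulOp b * mulOp a := by
  rcases a with - | i <;> rcases b with - | j <;> simp only [mulOp, mul_one, one_mul]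
  ext f v
  simp only [Module.End.mul_apply, conjMul_apply]
  ring

theorem diffOp_comm (a b : Option (Fin n)) : diffOp a * diffOp b = diffOp b * diffOp a := by
  rcases a with - | i <;> rcases b with - | j <;> simp only [diffOp, mul_zero, zero_mul]
  exact LinearMap.ext fun f => dHolo_dHolo i j f

theorem mulOp_diffOp_comm (a b : Option (Fin n)) : mulOp a * diffOp b = diffOp b * mulOp a := by
  rcases a with - | i <;> rcases b with - | j <;>
    simp only [mulOp, diffOp, mul_zero, zero_mul, mul_one, one_mul]
  exact LinearMap.ext fun f => (dHolo_conjMul j i f).symm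

/-- The operator on Schwartz functions that corresponds to an entry of the matrix of differential
operators. -/
noncomputable def entryOp (a b : Option (Fin n)) :
    Module.End ℂ (SchwartzMap (PhaseSpace n) ℂ) :=
  mulOp a * diffOp b + mulOp b * diffOp a

open scoped IsMulCommutative in
/-- The `3 × 3` minors of a symmetrized rank one matrix with commuting entries vanish. -/
theorem minor_entryOp (r c : Fin 3 → Option (Fin n)) :
    ∑ π : Equiv.Perm (Fin 3), ((Equiv.Perm.sign π : ℤ) : ℂ) •
      (entryOp (r 0) (c (π 0)) * (entryOp (r 1) (c (π 1)) * entryOp (r 2) (c (π 2)))) = 0 := by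
  set s : Set (Module.End ℂ (SchwartzMap (PhaseSpace n) ℂ)) :=
    Set.range mulOp ∪ Set.range diffOp
  have hs : ∀ a ∈ s, ∀ b ∈ s, a * b = b * a := by
    rintro _ (⟨a, rfl⟩ | ⟨a, rfl⟩) _ (⟨b, rfl⟩ | ⟨b, rfl⟩)
    · exact mulOp_comm a b
    · exact mulOp_diffOp_comm a b
    · exact (mulOp_diffOp_comm b a).symm
    · exact diffOp_comm a b
  -- The generators commute pairwise, so the determinant can be expanded inside a commutative
  -- subalgebra.
  have := Algebra.isMulCommutative_adjoin ℂ hs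
  set x : Option (Fin n) → Algebra.adjoin ℂ s := fun a =>
    ⟨mulOp a, Algebra.subset_adjoin (Or.inl ⟨a, rfl⟩)⟩
  set y : Option (Fin n) → Algebra.adjoin ℂ s := fun a =>
    ⟨diffOp a, Algebra.subset_adjoin (Or.inr ⟨a, rfl⟩)⟩
  -- The matrix is a sum of two rank-one matrices. Its indices are transposed because
  -- `Matrix.det_apply` multiplies the entries at `(π i, i)`.
  have key : (Matrix.of fun i j : Fin 3 => x (r j) * y (c i) + x (c i) * y (r j)).det = 0 := by
    rw [Matrix.det_fin_three]
    simp only [Matrix.of_apply]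
    ring
  rw [Matrix.det_apply] at key
  have key' := congrArg (Algebra.adjoin ℂ s).val key
  rw [map_sum, map_zero] at key'
  rw [← key']
  refine Finset.sum_congr rfl fun π _ => ?_
  rw [Fin.prod_univ_three, Units.smul_def, map_zsmul, map_mul, map_mul, Int.cast_smul_eq_zsmul,
    mul_assoc]
  rfl

/-! ### The first-derivative formula with its `S⁻¹` term -/

/-- The adjugate of the symmetric matrix, extended by zero. -/
noncomputable def adjEntry : Option (Fin n) → Option (Fin n) → SymmSpace n → ℂ
  | some i, some j => fun p => p.mat.adjugate i j
  | _, _ => 0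

theorem det_ne_zero {p : SymmSpace n} (hp : p ∈ lagrangianLocus n) : p.mat.det ≠ 0 := by
  intro h
  have := congrArg Matrix.det hp.1
  rw [Matrix.det_mul, h, zero_mul, Matrix.det_one] at this
  exact zero_ne_one this

theorem two_smul_symPart_single (i j : Fin n) :
    (2 : ℂ) • symPart (Matrix.single i j 1) =
      (Pi.single s(i, j) (if i = j then 2 else 1) : Sym2 (Fin n) → ℂ) := by
  funext z
  induction z with
  | _ k l =>
    rw [Pi.smul_apply, symPart_mk, Pi.single_apply, Matrix.single_apply, Matrix.single_apply]
    simp only [Sym2.eq_iff, smul_eq_mul]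
    by_cases h1 : i = k <;> by_cases h2 : j = l <;> by_cases h3 : i = l <;>
      by_cases h4 : j = k <;> simp_all <;> omega

/-- The choice `X = E_{ij} S⁻¹` moves `S` in the required direction, at the cost of a shift of `σ`
that `fderiv_vec_eq_radonLM` corrects. On the subspace `S⁻¹ h = h̄ - σ̄` replaces holomorphic
multipliers by conjugate ones. Tangential integration by parts trades `∂_{h̄}` for `∂_h`, and
commuting `∂_{h̄}` past `h̄_i` leaves the zeroth-order term `S⁻¹_{ij}`. -/
theorem fderiv_single_eq_radonComp (hp : p ∈ lagrangianLocus n) (hG : DifferentiableAt ℂ G p)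
    (hext : ∀ q ∈ lagrangianLocus n, G q = radonComp f q) (i j : Fin n) :
    fderiv ℂ G p (detDirection (some i) (some j)) =
      p.mat⁻¹ i j * G p + radonLM p (entryOp (some i) (some j) f) := by
  have hu : IsUnit p.mat.det := isUnit_iff_ne_zero.2 (det_ne_zero hp)
  set R := p.mat⁻¹
  have hRt : Rᵀ = R := by rw [Matrix.transpose_nonsing_inv, mat_transpose]
  have hRS : R * p.mat = 1 := Matrix.nonsing_inv_mul _ hu
  have hSR : p.mat * R = 1 := Matrix.mul_nonsing_inv _ hu
  have hσ : R *ᵥ p.vec = -star p.vec := by rw [hp.2, neg_neg]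
  set X : Matrix (Fin n) (Fin n) ℂ := Matrix.single i j 1 * R
  have hXS : X * p.mat = Matrix.single i j 1 := by rw [Matrix.mul_assoc, hRS, Matrix.mul_one]
  have hXσ : X *ᵥ p.vec = -star (p.vec j) • (Pi.single i 1 : Fin n → ℂ) := by
    rw [← Matrix.mulVec_mulVec, hσ]
    funext k
    simp [Matrix.single_mulVec, Pi.single_apply, Function.update_apply]
  have h1 := fderiv_mat_eq_radonLM hp hG hext X
  have h2 := fderiv_vec_eq_radonLM hp hG hext (Pi.single i 1)
  have hdir : detDirection (some i) (some j) = ((2 : ℂ) • symPart (X * p.mat), X *ᵥ p.vec) +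
      star (p.vec j) • ((0, Pi.single i 1) : SymmSpace n) := by
    rw [hXS, two_smul_symPart_single, hXσ]
    refine Prod.ext ?_ ?_
    · simp [detDirection]
    · simp [detDirection]
  have h3 : ∑ k, (Pi.single i 1 : Fin n → ℂ) k • dHolo k f = dHolo i f := by
    simp [Pi.single_apply]
  have h4 : matDeriv f X = ∑ l, R j l • holoMul l (dHolo i f) -
      ∑ l, R j l • dConj l (conjMul i f) + R j i • f := by
    have hX : ∀ k l, X k l = if k = i then R j l else 0 := fun k l => by
      simp only [X, Matrix.mul_apply, Matrix.single_apply]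
      by_cases h : k = i
      · subst h
        simp
      · simp [h, Ne.symm h]
    rw [matDeriv_apply]
    simp only [hX, dConj_conjMul, smul_sub, smul_add, Finset.sum_sub_distrib,
      Finset.sum_add_distrib, ite_smul, zero_smul, Finset.sum_ite_irrel, Finset.sum_const_zero,
      Finset.sum_ite_eq', Finset.sum_ite_eq, Finset.mem_univ, if_true, smul_ite, smul_zero,
      one_smul]
    abel
  have h5 : radonLM p (∑ l, R j l • holoMul l (dHolo i f)) =
      radonLM p (conjMul j (dHolo i f) - star (p.vec j) • dHolo i f) := by
    refine integralOver_eq_radonLM p fun v hv => ?_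
    rw [mem_affineLagrangian] at hv
    have hR := congrFun (congrArg (R *ᵥ ·) hv) j
    simp only [Matrix.mulVec_add, Matrix.mulVec_mulVec, hRS, Matrix.one_mulVec, hσ, Pi.add_apply,
      Pi.neg_apply, Pi.star_apply] at hR
    simp only [_root_.sum_apply, _root_.sub_apply, _root_.smul_apply, holoMul_apply, conjMul_apply,
      smul_eq_mul, ← mul_assoc]
    rw [← Finset.sum_mul]
    change (R *ᵥ holo v) j * _ = _
    rw [hR]
    ring
  have h6 : radonLM p (∑ l, R j l • dConj l (conjMul i f)) =
      -radonLM p (conjMul i (dHolo j f)) := by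
    have := radonLM_dirDeriv_tangent (conjMul i f) hp.1 (fun l => R j l)
    have hSd : p.mat *ᵥ (fun l => R j l) = Pi.single j 1 := by
      funext k
      have := congrFun (congrFun hSR k) j
      rw [Matrix.mul_apply, Matrix.one_apply] at this
      rw [Pi.single_apply, ← this]
      change ∑ l, p.mat k l * R j l = _
      exact Finset.sum_congr rfl fun l _ =>
        congrArg (p.mat k l * ·) (congrFun (congrFun hRt l) j)
    have h7 : ∑ k, (Pi.single j 1 : Fin n → ℂ) k • dHolo k (conjMul i f) =
        conjMul i (dHolo j f) := by
      simp [Pi.single_apply, dHolo_conjMul]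
    rw [dirDeriv_apply, hSd, h7, map_add] at this
    linear_combination this
  have hR : R j i = R i j := congrFun (congrFun hRt i) j
  have hop : entryOp (some i) (some j) f = conjMul i (dHolo j f) + conjMul j (dHolo i f) := rfl
  rw [hdir, map_add, map_smul, h1, h2, h3, h4, map_add, map_sub, h5, h6, map_sub, map_smul,
    map_smul, hop, map_add, hext p hp, hR, ← radonLM_apply]
  simp only [smul_eq_mul]
  ring

theorem det_mul_fderiv_eq (hp : p ∈ lagrangianLocus n) (hG : DifferentiableAt ℂ G p)
    (hext : ∀ q ∈ lagrangianLocus n, G q = radonComp f q) (a b : Option (Fin n)) :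
    p.mat.det * fderiv ℂ G p (detDirection a b) =
      adjEntry a b p * G p + p.mat.det * radonComp (entryOp a b f) p := by
  have hd := det_ne_zero hp
  have hv : ∀ i : Fin n, fderiv ℂ G p (0, Pi.single i 1) = radonComp (dHolo i f) p := fun i => by
    rw [fderiv_vec_eq_radonLM hp hG hext, ← radonLM_apply]
    congr 1
    simp [Pi.single_apply]
  rcases a with - | i <;> rcases b with - | j
  · have : entryOp none none f = 0 := by simp [entryOp, diffOp]
    rw [this, ← radonLM_apply]
    simp [detDirection, adjEntry]
  · have : entryOp none (some j) f = dHolo j f := by simp [entryOp, diffOp, mulOp]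
    rw [this, ← hv]
    simp [detDirection, adjEntry]
  · have : entryOp (some i) none f = dHolo i f := by simp [entryOp, diffOp, mulOp]
    rw [this, ← hv]
    simp [detDirection, adjEntry]
  · rw [fderiv_single_eq_radonComp hp hG hext, ← radonLM_apply, Matrix.inv_def, Ring.inverse_eq_inv',
      Matrix.smul_apply, smul_eq_mul]
    change _ = p.mat.adjugate i j * _ + _
    field_simp

/-! ### Derivative of the determinant and conjugation by powers of the branch -/

theorem analyticAt_mat (i j : Fin n) (p : SymmSpace n) :
    AnalyticAt ℂ (fun q : SymmSpace n => q.mat i j) p :=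
  (ContinuousLinearMap.proj (R := ℂ) (φ := fun _ : Sym2 (Fin n) => ℂ) s(i, j) ∘L
    ContinuousLinearMap.fst ℂ _ (Fin n → ℂ)).analyticAt p

theorem analyticAt_det {A : SymmSpace n → Matrix (Fin n) (Fin n) ℂ} {p : SymmSpace n}
    (hA : ∀ i j, AnalyticAt ℂ (fun q => A q i j) p) : AnalyticAt ℂ (fun q => (A q).det) p := by
  simp only [Matrix.det_apply']
  exact Finset.analyticAt_fun_sum _ fun π _ => analyticAt_const.mul
    (Finset.analyticAt_fun_prod _ fun i _ => hA _ _)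

theorem analyticAt_adjEntry (a b : Option (Fin n)) (p : SymmSpace n) :
    AnalyticAt ℂ (adjEntry a b) p := by
  rcases a with - | i <;> rcases b with - | j
  · exact analyticAt_const
  · exact analyticAt_const
  · exact analyticAt_const
  · simp only [adjEntry, Matrix.adjugate_apply]
    refine analyticAt_det fun k l => ?_
    simp only [Matrix.updateRow_apply]
    split_ifs
    · exact analyticAt_const
    · exact analyticAt_mat k l p

/-- Jacobi's formula: the direction is `E_{ij} + E_{ji}`, diagonal case included, and by symmetry
both summands contribute the same adjugate entry. -/
theorem fderiv_det (a b : Option (Fin n)) (p : SymmSpace n) :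
    fderiv ℂ (fun q : SymmSpace n => q.mat.det) p (detDirection a b) = 2 * adjEntry a b p := by
  let D : ContinuousMultilinearMap ℂ (fun _ : Fin n => Fin n → ℂ) ℂ :=
    { toMultilinearMap := (Matrix.detRowAlternating (R := ℂ) (n := Fin n)).toMultilinearMap
      cont := by
        have : Continuous fun A : Matrix (Fin n) (Fin n) ℂ => A.det := continuous_id.matrix_det
        exact this }
  let m : SymmSpace n →L[ℂ] (Fin n → Fin n → ℂ) := ContinuousLinearMap.pi fun i =>
    ContinuousLinearMap.pi fun j => ContinuousLinearMap.proj (R := ℂ)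
      (φ := fun _ : Sym2 (Fin n) => ℂ) s(i, j) ∘L ContinuousLinearMap.fst ℂ _ (Fin n → ℂ)
  have h : HasFDerivAt (fun q : SymmSpace n => q.mat.det) ((D.linearDeriv (m p)).comp m) p :=
    (D.hasFDerivAt (m p)).comp p m.hasFDerivAt
  have h1 : ∀ V : SymmSpace n, fderiv ℂ (fun q : SymmSpace n => q.mat.det) p V =
      ∑ k, (p.mat.updateRow k (V.mat k)).det := fun V => by
    rw [h.fderiv, ContinuousLinearMap.comp_apply, ContinuousMultilinearMap.linearDeriv_apply]
    rfl
  rw [h1]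
  have h0 : ∀ k, (p.mat.updateRow k (0 : Fin n → ℂ)).det = 0 := fun k =>
    Matrix.det_eq_zero_of_row_eq_zero k fun j => by simp
  have hz : ∀ σ : Fin n → ℂ, ∑ k, (p.mat.updateRow k
      (SymmSpace.mat ((0, σ) : SymmSpace n) k)).det = 2 * 0 := fun σ => by
    rw [mul_zero]
    exact Finset.sum_eq_zero fun k _ => h0 k
  rcases a with - | i <;> rcases b with - | j
  · exact hz 0
  · exact hz _
  · exact hz _
  · have hV : ∀ k, (detDirection (some i) (some j) : SymmSpace n).mat k =
        (if k = i then (1 : ℂ) else 0) • Pi.single j 1 +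
          (if k = j then (1 : ℂ) else 0) • Pi.single i 1 := by
      intro k
      funext l
      change (Pi.single s(i, j) (if i = j then 2 else 1) : Sym2 (Fin n) → ℂ) s(k, l) = _
      rw [← two_smul_symPart_single, Pi.smul_apply, symPart_mk]
      simp only [Matrix.single_apply, Pi.add_apply, Pi.smul_apply, Pi.single_apply, smul_eq_mul,
        @eq_comm _ i, @eq_comm _ j, ite_and]
      split_ifs <;> ring
    have hs : ∀ k, (p.mat.updateRow k ((detDirection (some i) (some j) : SymmSpace n).mat k)).det =
        (if k = i then (1 : ℂ) else 0) * p.mat.adjugate j k +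
          (if k = j then (1 : ℂ) else 0) * p.mat.adjugate i k := by
      intro k
      rw [hV, Matrix.det_updateRow_add, Matrix.det_updateRow_smul, Matrix.det_updateRow_smul,
        Matrix.adjugate_apply, Matrix.adjugate_apply]
    have ht : p.mat.adjugate j i = p.mat.adjugate i j := by
      have := Matrix.adjugate_transpose p.mat
      rw [mat_transpose] at this
      exact congrFun (congrFun this i) j
    simp only [hs, Finset.sum_add_distrib, ite_mul, one_mul, zero_mul, Finset.sum_ite_eq',
      Finset.mem_univ, if_true, ht, adjEntry]
    ring

/-- The operator conjugate to `∂_{ab}` under multiplication by `δ^{2k+1}`, where `δ^2 det = 1`,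
up to the factor `δ^2`. -/
noncomputable def opN (k : ℕ) (a b : Option (Fin n)) (g : SymmSpace n → ℂ) : SymmSpace n → ℂ :=
  fun p => p.mat.det * fderiv ℂ g p (detDirection a b) - (2 * k + 1) * adjEntry a b p * g p

theorem analyticOnNhd_fderiv_apply {g : SymmSpace n → ℂ} {O : Set (SymmSpace n)}
    (hg : AnalyticOnNhd ℂ g O) (v : SymmSpace n) :
    AnalyticOnNhd ℂ (fun p => fderiv ℂ g p v) O := fun p hp =>
  ((ContinuousLinearMap.apply ℂ ℂ v).analyticAt _).comp (hg.fderiv p hp)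

theorem analyticOnNhd_opN {g : SymmSpace n → ℂ} {O : Set (SymmSpace n)}
    (hg : AnalyticOnNhd ℂ g O) (k : ℕ) (a b : Option (Fin n)) :
    AnalyticOnNhd ℂ (opN k a b g) O := fun p hp =>
  ((analyticAt_det fun i j => analyticAt_mat i j p).mul
    (analyticOnNhd_fderiv_apply hg _ p hp)).sub
      ((analyticAt_const.mul (analyticAt_adjEntry a b p)).mul (hg p hp))

/-- Differentiating `δ² det = 1` gives `∂δ = -δ³ adj`. Each derivative therefore raises the odd
power of `δ` by two and leaves an operator with polynomial coefficients, free of the branch. -/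
theorem detEntry_branch {U : Set (SymmSpace n)} (hU : IsOpen U) {δ : SymmSpace n → ℂ}
    (hδ : AnalyticOnNhd ℂ δ U) (hbranch : ∀ p ∈ U, δ p ^ 2 * p.mat.det = 1) {k : ℕ}
    {F g : SymmSpace n → ℂ} (hg : AnalyticOnNhd ℂ g U)
    (hF : ∀ p ∈ U, F p = δ p ^ (2 * k + 1) * g p) (a b : Option (Fin n)) :
    ∀ p ∈ U, detEntry a b F p = δ p ^ (2 * (k + 1) + 1) * opN k a b g p := by
  intro p hp
  have hUp := hU.mem_nhds hp
  have hδp := (hδ p hp).differentiableAt.hasFDerivAt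
  have hgp := (hg p hp).differentiableAt.hasFDerivAt
  have hdet := (analyticAt_det fun i j => analyticAt_mat i j p).differentiableAt.hasFDerivAt
  have hb := hbranch p hp
  have h1 : fderiv ℂ δ p (detDirection a b) = -δ p ^ 3 * adjEntry a b p := by
    have e : (fun q : SymmSpace n => δ q ^ 2 * q.mat.det) =ᶠ[𝓝 p] fun _ => 1 :=
      Filter.eventually_of_mem hUp hbranch
    have h := ((hδp.pow 2).mul hdet).fderiv
    have h' := congrArg (· (detDirection a b)) (h.symm.trans (e.fderiv_eq.trans
      (hasFDerivAt_const (1 : ℂ) p).fderiv))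
    simp only [_root_.add_apply, _root_.smul_apply, smul_eq_mul, fderiv_det, _root_.zero_apply,
      Nat.cast_ofNat, nsmul_eq_mul] at h'
    linear_combination (δ p / 2) * h' - (fderiv ℂ δ p (detDirection a b)) * hb
  have h2 : F =ᶠ[𝓝 p] fun q => δ q ^ (2 * k + 1) * g q := Filter.eventually_of_mem hUp hF
  rw [detEntry, h2.fderiv_eq, ((hδp.pow (2 * k + 1)).fun_mul hgp).fderiv]
  simp only [_root_.add_apply, _root_.smul_apply, smul_eq_mul, h1, nsmul_eq_mul, opN, Nat.add_sub_cancel]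
  push_cast
  linear_combination (-δ p ^ (2 * k + 1) * fderiv ℂ g p (detDirection a b)) * hb

/-- Writing `g = det^k G`, the derivative of `det^k` contributes `2k adj`. Of the coefficient `2k +
1` exactly one `adj` survives, and it cancels the zeroth-order term of `det_mul_fderiv_eq`. -/
theorem opN_eq_of_eq {f : SchwartzMap (PhaseSpace n) ℂ} {g : SymmSpace n → ℂ} {k : ℕ}
    (hg : ∀ p ∈ lagrangianLocus n, DifferentiableAt ℂ g p)
    (h : ∀ p ∈ lagrangianLocus n, g p = p.mat.det ^ k * radonComp f p) (a b : Option (Fin n)) :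
    ∀ p ∈ lagrangianLocus n, opN k a b g p =
      p.mat.det ^ (k + 1) * radonComp (entryOp a b f) p := by
  intro p hp
  have hd := det_ne_zero hp
  set G : SymmSpace n → ℂ := fun q => (q.mat.det ^ k)⁻¹ * g q
  have hdet : DifferentiableAt ℂ (fun q : SymmSpace n => q.mat.det) p :=
    (analyticAt_det fun i j => analyticAt_mat i j p).differentiableAt
  have hG : DifferentiableAt ℂ G p :=
    ((hdet.pow k).fun_inv (pow_ne_zero k hd)).mul (hg p hp)
  have hGext : ∀ q ∈ lagrangianLocus n, G q = radonComp f q := fun q hq => by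
    simp only [G]
    rw [h q hq, inv_mul_cancel_left₀ (pow_ne_zero k (det_ne_zero hq))]
  have key := det_mul_fderiv_eq hp hG hGext a b
  have e : g =ᶠ[𝓝 p] fun q => q.mat.det ^ k * G q := by
    have : ∀ᶠ q : SymmSpace n in 𝓝 p, q.mat.det ≠ 0 := hdet.continuousAt.eventually_ne hd
    filter_upwards [this] with q hq
    simp only [G]
    rw [mul_inv_cancel_left₀ (pow_ne_zero k hq)]
  rw [opN, e.fderiv_eq, ((hdet.hasFDerivAt.pow k).fun_mul hG.hasFDerivAt).fderiv, e.eq_of_nhds]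
  simp only [_root_.add_apply, _root_.smul_apply, smul_eq_mul, fderiv_det, nsmul_eq_mul]
  -- The derivative of `det^k` involves the truncated exponent `k - 1`, so `k = 0` is separate.
  rcases k with - | k
  · simp only [pow_zero, Nat.cast_zero]
    linear_combination key
  · push_cast
    linear_combination (p.mat.det ^ (k + 1)) * key

/-! ### The locus as a set of uniqueness -/

/-- A function vanishing on the locus extends the transform of `f = 0`, so the derivative formula
annihilates it in every `detDirection`; these directions span the space. -/
theorem fderiv_eq_zero_of_eq_zero {H : SymmSpace n → ℂ} {p : SymmSpace n}
    (hp : p ∈ lagrangianLocus n) (hH : DifferentiableAt ℂ H p)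
    (h0 : ∀ q ∈ lagrangianLocus n, H q = 0) : fderiv ℂ H p = 0 := by
  have hz : ∀ q : SymmSpace n, radonComp 0 q = 0 := fun q => (radonLM q).map_zero
  have h : ∀ a b, fderiv ℂ H p (detDirection a b) = 0 := by
    intro a b
    have := det_mul_fderiv_eq (f := 0) hp hH (fun q hq => (h0 q hq).trans (hz q).symm) a b
    rw [map_zero, hz, h0 p hp, mul_zero, mul_zero, add_zero] at this
    exact (mul_eq_zero.1 this).resolve_left (det_ne_zero hp)
  have h1 : (fderiv ℂ H p).toLinearMap = 0 := by
    refine LinearMap.prod_ext (LinearMap.pi_ext fun z c => ?_) (LinearMap.pi_ext fun i c => ?_)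
    · induction z with
      | _ i j =>
        have e : ((Pi.single s(i, j) c, 0) : SymmSpace n) =
            (c / (if i = j then 2 else 1)) • detDirection (some i) (some j) := by
          refine Prod.ext ?_ (by simp [detDirection])
          change Pi.single s(i, j) c = (c / (if i = j then 2 else 1)) • Pi.single _ _
          rw [← Pi.single_smul, smul_eq_mul]
          congr 1
          split_ifs <;> simp
        change fderiv ℂ H p (Pi.single s(i, j) c, 0) = 0
        rw [e, map_smul, h, smul_zero]
    · have e : ((0, Pi.single i c) : SymmSpace n) = c • detDirection (some i) none := by
        refine Prod.ext (by simp [detDirection]) ?_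
        change Pi.single i c = c • Pi.single i 1
        rw [← Pi.single_smul, smul_eq_mul, mul_one]
      change fderiv ℂ H p (0, Pi.single i c) = 0
      rw [e, map_smul, h, smul_zero]
  exact ContinuousLinearMap.coe_injective h1

/-- The derivative in a fixed direction again vanishes on the locus, so induction applies. Diagonal
values suffice for the Taylor series. -/
theorem iteratedFDeriv_eq_zero_of_eq_zero {O : Set (SymmSpace n)} (hsub : lagrangianLocus n ⊆ O)
    (y : SymmSpace n) (m : ℕ) : ∀ {H : SymmSpace n → ℂ}, AnalyticOnNhd ℂ H O →
      (∀ q ∈ lagrangianLocus n, H q = 0) → ∀ p ∈ lagrangianLocus n,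
        iteratedFDeriv ℂ m H p (fun _ => y) = 0 := by
  induction m with
  | zero =>
    intro H _ h0 p hp
    exact h0 p hp
  | succ m ih =>
    intro H hH h0 p hp
    have h1 := ih (analyticOnNhd_fderiv_apply hH y) (fun q hq => by
      rw [fderiv_eq_zero_of_eq_zero hq (hH q (hsub hq)).differentiableAt h0]
      rfl) p hp
    have h2 : ContDiffAt ℂ m (fderiv ℂ H) p := (hH.fderiv p (hsub hp)).contDiffAt
    have h3 := (ContinuousLinearMap.apply ℂ ℂ y).iteratedFDeriv_comp_left h2 le_rfl
    rw [iteratedFDeriv_succ_apply_right]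
    have h4 := congrArg (· fun _ => y) h3
    exact h4.symm.trans h1

/-- The locus is a set of uniqueness for holomorphic functions. -/
theorem eqOn_zero_of_eq_zero_on_lagrangianLocus {O : Set (SymmSpace n)} (hO : IsConnected O)
    (hsub : lagrangianLocus n ⊆ O) {H : SymmSpace n → ℂ} (hH : AnalyticOnNhd ℂ H O)
    (h0 : ∀ q ∈ lagrangianLocus n, H q = 0) : ∀ p ∈ O, H p = 0 := by
  -- One point of the locus is enough: the Taylor series there is zero, and connectedness of `O`
  -- spreads this.
  have hp : ((symPart 1, 0) : SymmSpace n) ∈ lagrangianLocus n := by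
    have e : SymmSpace.mat ((symPart 1, 0) : SymmSpace n) = 1 :=
      mat_symPart Matrix.transpose_one _
    rw [mem_lagrangianLocus_iff, e]
    simp [SymmSpace.vec]
  set p₀ : SymmSpace n := (symPart 1, 0)
  obtain ⟨q, r, hq⟩ := hH p₀ (hsub hp)
  have hzero : H =ᶠ[𝓝 p₀] 0 := by
    refine Filter.eventually_of_mem (Metric.eball_mem_nhds p₀ hq.r_pos) fun x hx => ?_
    have hs := hq.hasSum_sub hx
    have ht : ∀ m, q m (fun _ => x - p₀) = 0 := fun m => by
      have h1 := hq.factorial_smul (x - p₀) m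
      rw [iteratedFDeriv_eq_zero_of_eq_zero hsub _ m hH h0 p₀ hp] at h1
      exact (smul_eq_zero.1 h1).resolve_left (Nat.factorial_ne_zero m)
    simp only [ht] at hs
    exact hs.unique hasSum_zero
  exact fun p hpO => hH.eqOn_zero_of_preconnected_of_eventuallyEq_zero hO.isPreconnected
    (hsub hp) hzero hpO

end LagrangianRadon

/-! ### Proof of the determinantal system -/

open LagrangianRadon

theorem mainTheorem8 (n : ℕ) (hn : 1 < n) (f : SchwartzMap (PhaseSpace n) ℂ)
    (O : Set (SymmSpace n)) (hO : IsOpen O) (hOconn : IsConnected O)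
    (hsub : lagrangianLocus n ⊆ O)
    (G : SymmSpace n → ℂ) (hG : AnalyticOnNhd ℂ G O)
    (hext : ∀ p ∈ lagrangianLocus n, G p = radonComp f p)
    (U : Set (SymmSpace n)) (hU : IsOpen U) (hUO : U ⊆ O)
    (δ : SymmSpace n → ℂ) (hδ : AnalyticOnNhd ℂ δ U)
    (hbranch : ∀ p ∈ U, δ p ^ 2 * p.mat.det = 1) :
    SatisfiesFlatSystem (fun p => δ p * G p) U := by
  intro r c p hp
  let N : Equiv.Perm (Fin 3) → SymmSpace n → ℂ := fun π =>
    opN 2 (r 0) (c (π 0)) (opN 1 (r 1) (c (π 1)) (opN 0 (r 2) (c (π 2)) G))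
  have hN0 : ∀ π : Equiv.Perm (Fin 3), AnalyticOnNhd ℂ (opN 0 (r 2) (c (π 2)) G) O :=
    fun π => analyticOnNhd_opN hG _ _ _
  have hN1 : ∀ π : Equiv.Perm (Fin 3),
      AnalyticOnNhd ℂ (opN 1 (r 1) (c (π 1)) (opN 0 (r 2) (c (π 2)) G)) O :=
    fun π => analyticOnNhd_opN (hN0 π) _ _ _
  have hN : ∀ π, AnalyticOnNhd ℂ (N π) O := fun π => analyticOnNhd_opN (hN1 π) _ _ _
  -- The minor stripped of its power of `δ`. It is analytic on all of `O`, including points where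
  -- `det S = 0`, so uniqueness from the locus applies without choosing a branch.
  let H : SymmSpace n → ℂ := fun p => ∑ π : Equiv.Perm (Fin 3),
    ((Equiv.Perm.sign π : ℤ) : ℂ) * N π p
  have hH : AnalyticOnNhd ℂ H O := fun q hq =>
    Finset.analyticAt_fun_sum _ fun π _ => analyticAt_const.mul (hN π q hq)
  have hH0 : ∀ q ∈ lagrangianLocus n, H q = 0 := by
    intro q hq
    have hd : ∀ {g : SymmSpace n → ℂ}, AnalyticOnNhd ℂ g O → ∀ p ∈ lagrangianLocus n,
        DifferentiableAt ℂ g p := fun hg p hp => (hg p (hsub hp)).differentiableAt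
    have hNq : ∀ π, N π q = q.mat.det ^ 3 * radonLM q ((entryOp (r 0) (c (π 0)) *
        (entryOp (r 1) (c (π 1)) * entryOp (r 2) (c (π 2)))) f) := fun π =>
      opN_eq_of_eq (hd (hN1 π)) (opN_eq_of_eq (hd (hN0 π)) (opN_eq_of_eq (hd hG)
        (fun q hq => by rw [pow_zero, one_mul, hext q hq]) _ _) _ _) _ _ q hq
    have key := congrArg (fun T => radonLM q (T f)) (minor_entryOp r c)
    simp only [LinearMap.sum_apply, LinearMap.smul_apply, map_sum, map_smul, smul_eq_mul,
      LinearMap.zero_apply, map_zero] at key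
    simp only [H, hNq, mul_left_comm _ (q.mat.det ^ 3)]
    rw [← Finset.mul_sum, key, mul_zero]
  have hzero := eqOn_zero_of_eq_zero_on_lagrangianLocus hOconn hsub hH hH0 p (hUO hp)
  -- Three derivatives raise the power of `δ` from 1 through 3 and 5 to 7, independently of `π`.
  have hD : ∀ π : Equiv.Perm (Fin 3), detEntry (r 0) (c (π 0)) (detEntry (r 1) (c (π 1))
      (detEntry (r 2) (c (π 2)) fun p => δ p * G p)) p = δ p ^ 7 * N π p := fun π =>
    detEntry_branch hU hδ hbranch ((hN1 π).mono hUO) (detEntry_branch hU hδ hbranch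
      ((hN0 π).mono hUO) (detEntry_branch (k := 0) hU hδ hbranch (hG.mono hUO)
        (fun q _ => by rw [mul_zero, zero_add, pow_one]) _ _) _ _) _ _ p hp
  simp only [detMinor, hD, mul_left_comm _ (δ p ^ 7)]
  rw [← Finset.mul_sum]
  exact mul_eq_zero_of_right _ hzero
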